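/- **Setting.** Let $G=(V,E)$ be an undirected graph with $n\ge 2$ vertices, $m$ edges and positive edge weights, and let $d$ be its shortest-path distance ($\infty$ between different components). A *relaxed (core-fringe) tree decomposition* of $G$ is a tree decomposition $(\{X_t\}_{t\in V_T},T)$ with a root $t_r$ such that $|X_{t_r}|=w_m$ and $|X_t|\le c$ for all $t\ne t_r$, where $c\ge 1$. Assume that it has polynomially many bags, $|V_T|\le n^K$ for a fixed $K$. Let $T'$ be obtained from $T$ by replacing each subtree rooted at a child of $t_r$ by a centroid decomposition of it. An *induced ranking* $R$ is a total order of $V$ (a bijection to $\{0,\dots,n-1\}$) in which $v$ is ranked by the minimum depth in $T'$ of a bag containing $v$, smaller depth being ranked higher and ties being broken arbitrarily. **Algorithm.** A hub label of $v$ is a pair $(h,\delta)$ of a vertex $h$ and a length. A cluster of $q\ge1$ nodes with $p\ge1$ threads each builds one shortest path tree (SPT) per root, in decreasing order of rank; the root $h$ belongs to node $R(h)\bmod q$, which stores all labels with hub $h$. *Hybrid PLaNT+DGLL* builds the SPTs of the $w_m$ highest ranked roots by PLaNT: an unpruned Dijkstra run from $h$ that also propagates the highest ranked vertex on the path (maximised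 over ties between shortest paths), inserts a label with hub $h$ at a popped vertex $v$ iff no vertex of that path is ranked higher than $h$, and stops when no queued vertex can lead to a label. Then it switches to DGLL: the remaining roots are processed in supersteps (consecutive groups of roots of arbitrary positive sizes). Within a superstep each node runs Dijkstra from its roots, concurrently in its threads; a popped vertex $v$ is pruned if it is ranked higher than $h$ or if the labels of $v$ and (as of the start of the tree) of $h$ on that node have a common hub giving a distance at most the tentative one; otherwise a label is inserted at $v$ and the edges at $v$ are relaxed. At the end of the superstep all its labels are broadcast, and a label $(h,\delta)$ of $v$ is deleted if the labels of $v$ and $h$ on all nodes have a common hub ranked higher than $h$ giving a distance at most $\delta$. *Work* is the total number of elementary steps of all threads on all nodes: each scanned edge, label entry, touched array entry or query counts $1$, each priority queue operation counts $O(\log n)$ (binary heap), and sorting $k$ labels counts $O(k\log k)$. *Data broadcast* is the number of labels broadcast. A *query* $(x,y)$ intersects the label lists of $x$ and $y$, sorted by hub rank, and returns the minimum of $\delta+\delta'$ over common hubs. **Statement.** For every induced ranking, all $q,p$, all superstep sizes and every interleaving of the threads, the algorithm terminates, and 1. it performs $O\big(m\log n\,(w_m+c\log^2 n)+nc\log n\,(w_m+c\log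 n)\big)$ work; 2. it broadcasts $O(cn\log n)$ data; 3. it generates $O\big(n(w_m+c\log n)\big)$ hub labels (even when labels that are deleted later are counted); 4. with the resulting labels every query $(x,y)$ returns $d(x,y)$ in $O(w_m+c\log n)$ time. The constants in $O(\cdot)$ depend only on $K$. -/

import Mathlib

universe u v

namespace HubLabeling

open scoped NNReal ENNReal Classical

noncomputable section

/-! ### Relaxed tree decompositions and the ranking they induce -/

/-- A relaxed (core-fringe) tree decomposition of `G`: a rooted tree decomposition whose root bag
has exactly `w` vertices and whose other bags have at most `c` vertices each. -/
structure RelaxedTreeDecomposition {V : Type u} (G : SimpleGraph V) (w c : ℕ) (τ : Type v) where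
  tree : SimpleGraph τ
  isTree : tree.IsTree
  bag : τ → Finset V
  root : τ
  edge_covered : ∀ x y, G.Adj x y → ∃ t, x ∈ bag t ∧ y ∈ bag t
  /-- The bags that contain a given vertex form a (nonempty) subtree. -/
  connected : ∀ x, (tree.induce {t | x ∈ bag t}).Connected
  card_root : (bag root).card = w
  card_le : ∀ t, t ≠ root → (bag t).card ≤ c

/-- The connected component of `x` in the subgraph of `T` induced on `A` (empty if `x ∉ A`). -/
def component {τ : Type v} (T : SimpleGraph τ) (A : Set τ) (x : τ) : Set τ :=
  {y | ∃ (hx : x ∈ A) (hy : y ∈ A), (T.induce A).Reachable ⟨x, hx⟩ ⟨y, hy⟩}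

/-- `CentroidDepth T dep k A`: on the subtree of `T` with node set `A`, `dep` is the depth function
of a centroid decomposition whose root is placed at depth `k`. The root is a centroid `z` of `A`,
i.e. all components of `A \ {z}` have at most `|A| / 2` nodes; these components are decomposed
recursively, with their roots at depth `k + 1`. -/
inductive CentroidDepth {τ : Type v} (T : SimpleGraph τ) (dep : τ → ℕ) : ℕ → Set τ → Prop
  | node (k : ℕ) (A : Set τ) (z : τ) (hz : z ∈ A) (hdep : dep z = k)
      (centroid : ∀ x ∈ A \ {z}, 2 * (component T (A \ {z}) x).ncard ≤ A.ncard)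
      (rec : ∀ x ∈ A \ {z}, CentroidDepth T dep (k + 1) (component T (A \ {z}) x)) :
      CentroidDepth T dep k A

namespace RelaxedTreeDecomposition

variable {V : Type u} {G : SimpleGraph V} {w c : ℕ} {τ : Type v}

/-- `dep` is the depth function of the tree obtained from the decomposition tree by keeping the root
(at depth `0`) and replacing each subtree hanging below the root by a centroid decomposition of it,
whose root becomes a child of the root. -/
def IsCentroidDepth (D : RelaxedTreeDecomposition G w c τ) (dep : τ → ℕ) : Prop :=
  dep D.root = 0 ∧
    ∀ x, x ≠ D.root → CentroidDepth D.tree dep 1 (component D.tree {D.root}ᶜ x)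

/-- The minimum depth of a bag that contains `x`. -/
def vertexDepth (D : RelaxedTreeDecomposition G w c τ) (dep : τ → ℕ) (x : V) : ℕ :=
  sInf (dep '' {t | x ∈ D.bag t})

/-- `R` (larger values are more important) is a ranking induced by the decomposition: for some
choice of the centroids, vertices are ranked by the minimum depth of their bags, with smaller depths
ranked higher and ties broken arbitrarily. -/
def Induces [Fintype V] (D : RelaxedTreeDecomposition G w c τ)
    (R : V ≃ Fin (Fintype.card V)) : Prop :=
  ∃ dep : τ → ℕ, D.IsCentroidDepth dep ∧
    ∀ x y, D.vertexDepth dep x < D.vertexDepth dep y → R y < R x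

end RelaxedTreeDecomposition

/-! ### Input and state of the hybrid algorithm -/

/-- The input and the parameters of the hybrid algorithm. -/
structure Setup (V : Type u) [Fintype V] where
  /-- the graph -/
  G : SimpleGraph V
  /-- the edge weights (only the values on edges matter) -/
  wt : Sym2 V → ℝ≥0
  /-- the ranking; larger values are more important -/
  R : V ≃ Fin (Fintype.card V)
  /-- the number of cluster nodes -/
  q : ℕ
  /-- the number of threads per cluster node -/
  p : ℕ
  /-- the number of shortest path trees built by PLaNT before switching to DGLL -/
  k : ℕ
  /-- `s i` is the number of trees built in the `i`-th DGLL superstep (e.g. `x * β ^ i`) -/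
  s : ℕ → ℕ

/-- A hub label `(hub, d)` of the vertex `vertex`. -/
structure Label (V : Type u) where
  vertex : V
  hub : V
  d : ℝ≥0∞

/-- State of one PLaNT Dijkstra: tentative distances, ancestors, priority queue. -/
structure PlantTree (V : Type u) where
  dist : V → ℝ≥0∞
  anc : V → V
  queue : Finset V

/-- State of one pruned Dijkstra: tentative distances, priority queue, and the labels `LR` of the
root, hashed when the tree was started. -/
structure GllTree (V : Type u) where
  dist : V → ℝ≥0∞
  queue : Finset V
  LR : Finset (Label V)

/-- Status of the shortest path tree of a root. -/
inductive Status (V : Type u)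
  | waiting
  | plant (t : PlantTree V)
  | gll (t : GllTree V)
  | done

/-- Global state of the cluster. -/
structure Config (V : Type u) where
  /-- `0` is the PLaNT phase, `i + 1` is the `i`-th DGLL superstep -/
  superstep : ℕ
  status : V → Status V
  /-- union of the global label tables of all nodes -/
  glob : Finset (Label V)
  /-- union of the local label tables of all nodes (labels of the current superstep) -/
  loc : Finset (Label V)
  /-- number of labels inserted so far, including those that are cleaned later -/
  generated : ℕ
  /-- number of elementary steps carried out so far by all threads of all nodes -/
  work : ℕ
  /-- number of labels broadcast so far -/
  broadcast : ℕ

variable {V : Type u}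

/-- Shortest path distance (`⊤` between different components). -/
def wdist (G : SimpleGraph V) (wt : Sym2 V → ℝ≥0) (x y : V) : ℝ≥0∞ :=
  ⨅ P : G.Walk x y, (((P.edges.map wt).sum : ℝ≥0) : ℝ≥0∞)

/-- The labels of the vertex `x` in the table `L`. -/
def labelsAt (L : Finset (Label V)) (x : V) : Finset (Label V) := L.filter fun l => l.vertex = x

/-- `x` may be popped from a priority queue `Q` keyed by `δ`. -/
def IsHead (Q : Finset V) (δ : V → ℝ≥0∞) (x : V) : Prop := x ∈ Q ∧ ∀ y ∈ Q, δ x ≤ δ y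

/-- Steps for sorting `K` items. -/
def sortCost (K : ℕ) : ℕ := K * (Nat.log 2 K + 1)

/-- The number of array entries touched by a Dijkstra run with tentative distances `δ`; these are
the entries that have to be reset for the next run. -/
def touched [Fintype V] (δ : V → ℝ≥0∞) : ℕ := (Finset.univ.filter fun x => δ x ≠ ⊤).card

/-- Initially no tree has been started and all tables are empty. -/
def Config.init : Config V where
  superstep := 0
  status := fun _ => .waiting
  glob := ∅
  loc := ∅
  generated := 0
  work := 0
  broadcast := 0

/-- Start of a PLaNT Dijkstra from `h`. -/
def PlantTree.init (h : V) : PlantTree V where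
  dist := Function.update (fun _ => ⊤) h 0
  anc := id
  queue := {h}

/-- Start of a pruned Dijkstra from `h`. -/
def GllTree.init (h : V) (LR : Finset (Label V)) : GllTree V where
  dist := Function.update (fun _ => ⊤) h 0
  queue := {h}
  LR := LR

namespace Setup

variable [Fintype V] (S : Setup V)

/-- Steps of one priority queue operation (insert, decrease-key, pop) in a binary heap with at most
`|V|` entries. -/
def heapCost : ℕ := Nat.log 2 (Fintype.card V) + 1

/-- Steps for scanning all neighbours of `x`, each with an update of the queue. -/
def scanCost (x : V) : ℕ := (S.G.neighborSet x).ncard * (1 + heapCost (V := V))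

/-- The more important of two vertices. -/
def higher (x y : V) : V := if S.R x < S.R y then y else x

/-- The cluster node in charge of the tree rooted at `h` (rank-circular assignment); this node also
stores all labels with hub `h`. -/
def nodeOf (h : V) : ℕ := (S.R h : ℕ) % S.q

/-- Position of `h` in the order of decreasing rank, starting from `0`. -/
def treeId (h : V) : ℕ := ((S.R h).rev : ℕ)

/-- The position of the first root of each phase: phase `0` (PLaNT) takes the `k` highest ranked
roots, phase `i + 1` takes the next `s i` roots. -/
def first : ℕ → ℕ
  | 0 => 0
  | j + 1 => S.k + ∑ i ∈ Finset.range j, S.s i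

/-- `h` is one of the roots of phase `j`. -/
def InBatch (j : ℕ) (h : V) : Prop := S.first j ≤ S.treeId h ∧ S.treeId h < S.first (j + 1)

/-- A free thread of the node in charge of `h` may start the tree of `h`: it is the highest ranked
root of the current phase on that node which has not been started. -/
def CanStart (C : Config V) (h : V) : Prop :=
  S.InBatch C.superstep h ∧ C.status h = .waiting ∧
  (∀ h', S.InBatch C.superstep h' → S.nodeOf h' = S.nodeOf h → S.R h < S.R h' →
    C.status h' ≠ .waiting) ∧
  (Finset.univ.filter fun h' => S.nodeOf h' = S.nodeOf h ∧
    C.status h' ≠ .waiting ∧ C.status h' ≠ .done).card < S.p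

/-- The labels of `x` that are stored on the node in charge of `h`. -/
def nodeLabels (C : Config V) (h x : V) : Finset (Label V) :=
  (labelsAt (C.glob ∪ C.loc) x).filter fun l => S.nodeOf l.hub = S.nodeOf h

/-- Tentative distances after relaxing all edges at `x`. -/
def relax (δ : V → ℝ≥0∞) (x : V) : V → ℝ≥0∞ := fun y =>
  if S.G.Adj x y then min (δ y) (δ x + S.wt s(x, y)) else δ y

/-- Queue after popping `x` and relaxing all edges at `x`. -/
def relaxQueue (δ : V → ℝ≥0∞) (Q : Finset V) (x : V) : Finset V :=
  Q.erase x ∪ Finset.univ.filter fun y => S.G.Adj x y ∧ δ x + S.wt s(x, y) < δ y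

/-! ### PLaNT -/

/-- The most important vertex on the selected shortest path to `x`, including `x`. -/
def topAnc (t : PlantTree V) (x : V) : V := S.higher x (t.anc x)

/-- Pop `x` and relax its edges, propagating ancestors; on equal distances the path with the higher
ranked ancestor is selected. The tree is not pruned. -/
def plantIter (t : PlantTree V) (x : V) : PlantTree V where
  dist := S.relax t.dist x
  anc := fun y =>
    if S.G.Adj x y then
      if t.dist x + S.wt s(x, y) < t.dist y then S.higher (S.topAnc t x) y
      else if t.dist x + S.wt s(x, y) = t.dist y then S.higher (S.topAnc t x) (t.anc y)
      else t.anc y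
    else t.anc y
  queue := S.relaxQueue t.dist t.queue x

/-- The label generated when `x` is popped in the tree of `h`: none if `x` or its ancestor is ranked
higher than `h`. -/
def plantLabel (t : PlantTree V) (h x : V) : Finset (Label V) :=
  if S.R h < S.R (S.topAnc t x) then ∅ else {⟨x, h, t.dist x⟩}

/-! ### Pruned Dijkstra with rank and distance queries -/

/-- The distance query: the labels `Lx` of `x` and the hashed labels of the root have a common hub
through which the distance is at most `δ`. -/
def DistQuery (Lx LR : Finset (Label V)) (δ : ℝ≥0∞) : Prop :=
  ∃ a ∈ Lx, ∃ b ∈ LR, a.hub = b.hub ∧ a.d + b.d ≤ δ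

/-- Popping `x` in the tree of `h` neither fails the rank query nor the distance query. -/
def GllAccepts (C : Config V) (t : GllTree V) (h x : V) : Prop :=
  S.R x ≤ S.R h ∧ ¬ DistQuery (S.nodeLabels C h x) t.LR (t.dist x)

/-- Pop `x`; its edges are relaxed only if `x` is not pruned. -/
def gllIter (C : Config V) (t : GllTree V) (h x : V) : GllTree V where
  dist := if S.GllAccepts C t h x then S.relax t.dist x else t.dist
  queue := if S.GllAccepts C t h x then S.relaxQueue t.dist t.queue x else t.queue.erase x
  LR := t.LR

/-- The label generated when `x` is popped. -/
def gllLabel (C : Config V) (t : GllTree V) (h x : V) : Finset (Label V) :=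
  if S.GllAccepts C t h x then {⟨x, h, t.dist x⟩} else ∅

/-- Steps of one iteration: pop and rank query; scan of the labels of `x` on this node for the
distance query, if `x` passes the rank query; scan of the neighbours, if `x` is not pruned. -/
def gllCost (C : Config V) (t : GllTree V) (h x : V) : ℕ :=
  1 + heapCost (V := V) + (if S.R x ≤ S.R h then (S.nodeLabels C h x).card else 0) +
    (if S.GllAccepts C t h x then 1 + S.scanCost x else 0)

/-- The cleaning query: `l` is redundant because its vertex and its hub have a common hub of higher
rank, in the tables of any node, through which the distance is at most `l.d`. -/
def Redundant (L : Finset (Label V)) (l : Label V) : Prop :=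
  ∃ a ∈ labelsAt L l.vertex, ∃ b ∈ labelsAt L l.hub,
    a.hub = b.hub ∧ a.d + b.d ≤ l.d ∧ S.R l.hub < S.R a.hub

/-- Steps for cleaning the labels `loc` against the tables `L`: every cleaning query scans the
labels of both vertices, each on the node where it is stored. -/
def cleanCost (L loc : Finset (Label V)) : ℕ :=
  ∑ l ∈ loc, (1 + (labelsAt L l.vertex).card + (labelsAt L l.hub).card)

/-! ### The hybrid algorithm -/

/-- One step of the hybrid algorithm. In each phase the threads of all nodes run interleaved, one
loop iteration at a time, in any order; ties in the priority queues are broken arbitrarily. -/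
inductive Step : Config V → Config V → Prop
  /-- A thread starts planting the tree of `h`. -/
  | startPlant (C : Config V) (h : V) (phase : C.superstep = 0) (start : S.CanStart C h) :
      Step C { C with
        status := Function.update C.status h (.plant (PlantTree.init h))
        work := C.work + 1 }
  /-- One iteration of PLaNT Dijkstra, as long as some queued vertex has ancestor `h`. -/
  | iterPlant (C : Config V) (h x : V) (t : PlantTree V) (ht : C.status h = .plant t)
      (live : ∃ y ∈ t.queue, t.anc y = h) (head : IsHead t.queue t.dist x) :
      Step C { C with
        status := Function.update C.status h (.plant (S.plantIter t x))
        loc := C.loc ∪ S.plantLabel t h x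
        generated := C.generated + (S.plantLabel t h x).card
        work := C.work + (1 + heapCost (V := V) + (S.plantLabel t h x).card + S.scanCost x) }
  /-- End of a planted tree; the queue is empty or the early termination condition holds. -/
  | endPlant (C : Config V) (h : V) (t : PlantTree V) (ht : C.status h = .plant t)
      (dead : ∀ y ∈ t.queue, t.anc y ≠ h) :
      Step C { C with
        status := Function.update C.status h .done
        work := C.work + (1 + touched t.dist) }
  /-- All planted trees are complete: every node sorts and keeps its labels; nothing is broadcast. -/
  | switch (C : Config V) (phase : C.superstep = 0)
      (complete : ∀ h, S.InBatch 0 h → C.status h = .done) :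
      Step C { C with
        superstep := 1
        glob := C.glob ∪ C.loc
        loc := ∅
        work := C.work + (1 + sortCost C.loc.card) }
  /-- A thread starts the pruned tree of `h` and hashes the labels of `h` stored on its node. -/
  | startGll (C : Config V) (h : V) (phase : C.superstep ≠ 0) (start : S.CanStart C h) :
      Step C { C with
        status := Function.update C.status h (.gll (GllTree.init h (S.nodeLabels C h h)))
        work := C.work + (1 + (S.nodeLabels C h h).card) }
  /-- One iteration of pruned Dijkstra. -/
  | iterGll (C : Config V) (h x : V) (t : GllTree V) (ht : C.status h = .gll t)
      (head : IsHead t.queue t.dist x) :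
      Step C { C with
        status := Function.update C.status h (.gll (S.gllIter C t h x))
        loc := C.loc ∪ S.gllLabel C t h x
        generated := C.generated + (S.gllLabel C t h x).card
        work := C.work + S.gllCost C t h x }
  /-- End of a pruned tree. -/
  | endGll (C : Config V) (h : V) (t : GllTree V) (ht : C.status h = .gll t)
      (empty : t.queue = ∅) :
      Step C { C with
        status := Function.update C.status h .done
        work := C.work + (1 + touched t.dist) }
  /-- End of a DGLL superstep: all labels of the superstep, redundant or not, are sorted, broadcast
  and cleaned, and those that are not redundant are moved to the global tables. -/
  | sync (C : Config V) (phase : C.superstep ≠ 0) (more : S.first C.superstep < Fintype.card V)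
      (complete : ∀ h, S.InBatch C.superstep h → C.status h = .done) :
      Step C { C with
        superstep := C.superstep + 1
        glob := C.glob ∪ C.loc.filter fun l => ¬ S.Redundant (C.glob ∪ C.loc) l
        loc := ∅
        work := C.work + (1 + sortCost C.loc.card + cleanCost (C.glob ∪ C.loc) C.loc)
        broadcast := C.broadcast + C.loc.card }

/-- `C'` can be reached from `C` by steps of the hybrid algorithm. -/
def Reaches (C C' : Config V) : Prop := Relation.ReflTransGen S.Step C C'

/-- The algorithm has finished: all phases that contain roots have been completed. -/
def Finished (C : Config V) : Prop := Fintype.card V ≤ S.first C.superstep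

/-! ### Queries -/

/-- Intersection of two label lists sorted by decreasing rank of the hubs. Returns the least
distance through a common hub (`⊤` if there is none) and the number of steps. -/
def mergeQuery : List (Label V) → List (Label V) → ℝ≥0∞ × ℕ
  | [], _ => (⊤, 1)
  | _ :: _, [] => (⊤, 1)
  | a :: as, b :: bs =>
    if a.hub = b.hub then
      (min (a.d + b.d) (mergeQuery as bs).1, (mergeQuery as bs).2 + 1)
    else if S.R b.hub < S.R a.hub then
      ((mergeQuery as (b :: bs)).1, (mergeQuery as (b :: bs)).2 + 1)
    else
      ((mergeQuery (a :: as) bs).1, (mergeQuery (a :: as) bs).2 + 1)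
  termination_by as bs => as.length + bs.length

/-- The labels of `x` in `L`, sorted by decreasing rank of the hubs. -/
def sortedLabels (L : Finset (Label V)) (x : V) : List (Label V) :=
  (labelsAt L x).toList.mergeSort fun a b => decide (S.R b.hub ≤ S.R a.hub)

/-- A distance query between `x` and `y`: the answer and the number of steps. -/
def query (L : Finset (Label V)) (x y : V) : ℝ≥0∞ × ℕ :=
  S.mergeQuery (S.sortedLabels L x) (S.sortedLabels L y)

end Setup

end

end HubLabeling

/-!
Fix the ranking. A pair `(h, x)` is called canonical (`Setup.Canon`) if `h` is the highest ranked
vertex on all shortest paths between `h` and `x`.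

*Correctness.* The highest ranked vertex on the shortest paths between `x` and `y` is canonical for
both, so the labels of canonical pairs answer all queries (`Setup.exists_canon_canon`,
`TableInv.query_eq`), provided that no label has too small a distance. The algorithm generates all
canonical labels and never deletes one. Canonical pairs are closed under taking prefixes of shortest
paths, so a Dijkstra run from `h` that relaxes all canonical vertices has the right distances on
them, whatever else is pruned (`DijkstraInv.exists_mem_queue`). PLaNT prunes nothing, and a queued
canonical vertex has ancestor `h`, which justifies the early termination
(`PlantInv.canon_mem_of_dead`). In DGLL a label that would prune a canonical `x` has its hub on a
shortest path from `h` to `x`; this hub is ranked lower than `h`, but hubs of labels of `h` are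
ranked higher (`GllInv.accepts_of_canon`). The same argument protects canonical labels from cleaning
(`TableInv.not_redundant`). None of this depends on the interleaving of the threads.

*Number of labels.* The `w` vertices of the root bag are the `w` highest ranked ones, and PLaNT
builds their trees. In every other tree, `x` gets a label with hub `h` only if it is reached from
`h` through vertices ranked below `h` (`Setup.LowReach`). In the centroid decomposition such a walk
cannot meet the separators above the one containing `h`, since their vertices are ranked higher, so
on every level all hubs of `x` are in a single bag. As sizes halve from level to level, `x` has at
most `B = c (log₂ |τ| + 1)` of these hubs (`CentroidDepth.card_hubs_le`).

*Work.* The pops of DGLL that pass the rank query are among the pairs in `Setup.LowReach`, and all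
other pops are paid for by the edges scanned at accepted vertices. Hence the work of each tree is
bounded by a sum over the vertices it reaches, and exchanging the sums gives the total
(`Setup.HubBound.sum_le`, `GlobalInv.work_le_budget`). The bookkeeping is carried by `GlobalInv`,
an invariant of all executions that refers to the `History` of each tree. Every step costs work and
a step is possible until the algorithm has finished, so the bound on the work implies termination
(`Setup.exists_finished`).
-/

namespace HubLabeling

open scoped NNReal ENNReal Classical

noncomputable section

/-! ### Shortest path distances -/

section Distance

variable {V : Type u} {G : SimpleGraph V} {wt : Sym2 V → ℝ≥0}

theorem wdist_self (x : V) : wdist G wt x x = 0 :=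
  le_antisymm ((iInf_le _ SimpleGraph.Walk.nil).trans (by simp)) bot_le

theorem wdist_le_swap (x y : V) : wdist G wt x y ≤ wdist G wt y x :=
  le_iInf fun P => (iInf_le _ P.reverse).trans (by
    simp [SimpleGraph.Walk.edges_reverse, List.map_reverse, List.sum_reverse])

theorem wdist_comm (x y : V) : wdist G wt x y = wdist G wt y x :=
  le_antisymm (wdist_le_swap x y) (wdist_le_swap y x)

theorem wdist_triangle (x y z : V) : wdist G wt x z ≤ wdist G wt x y + wdist G wt y z := by
  unfold wdist
  rw [ENNReal.iInf_add]
  refine le_iInf fun P => ?_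
  rw [ENNReal.add_iInf]
  refine le_iInf fun Q => (iInf_le _ (P.append Q)).trans ?_
  simp [SimpleGraph.Walk.edges_append]

theorem wdist_le_of_adj {x y : V} (h : G.Adj x y) : wdist G wt x y ≤ wt s(x, y) :=
  (iInf_le _ (SimpleGraph.Walk.cons h .nil)).trans (by simp)

theorem wdist_adj_right (h : V) {x y : V} (hxy : G.Adj x y) :
    wdist G wt h y ≤ wdist G wt h x + wt s(x, y) :=
  (wdist_triangle h x y).trans (add_le_add_right (wdist_le_of_adj hxy) _)

/-- On a finite graph the last edge of a shortest path exists. -/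
theorem exists_adj_wdist_add_le [Finite V] {h y : V} (hy : y ≠ h) (hd : wdist G wt h y ≠ ⊤) :
    ∃ u, G.Adj u y ∧ wdist G wt h u + wt s(u, y) ≤ wdist G wt h y := by
  let f : V → ℝ≥0∞ := fun u => if G.Adj u y then wdist G wt h u + wt s(u, y) else ⊤
  have : Nonempty V := ⟨y⟩
  obtain ⟨u, hu⟩ := Finite.exists_min f
  have key : f u ≤ wdist G wt h y := by
    rw [wdist_comm]
    refine le_iInf fun P => ?_
    cases P with
    | nil => exact absurd rfl hy
    | @cons _ a _ hadj p =>
      refine (hu a).trans ?_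
      simp only [f, if_pos hadj.symm, SimpleGraph.Walk.edges_cons, List.map_cons, List.sum_cons]
      rw [add_comm, ENNReal.coe_add, Sym2.eq_swap, wdist_comm]
      exact add_le_add_right (iInf_le _ p) _
  by_cases hadj : G.Adj u y
  · exact ⟨u, hadj, by simpa [f, hadj] using key⟩
  · simp only [f, if_neg hadj, top_le_iff] at key
    exact absurd key hd

end Distance

section Canonical

variable {V : Type u} [Fintype V] (S : Setup V)

/-- Shortest path distance in the graph of `S`. -/
abbrev Setup.dist (x y : V) : ℝ≥0∞ := wdist S.G S.wt x y

/-- `h` is the highest ranked vertex on the shortest paths between `h` and `x`, and there is such a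
path. A vertex `z` lies on one of them iff `dist h z + dist z x ≤ dist h x`. -/
def Setup.Canon (h x : V) : Prop :=
  S.dist h x ≠ ⊤ ∧ ∀ z, S.dist h z + S.dist z x ≤ S.dist h x → S.R z ≤ S.R h

variable {S}

theorem Setup.Canon.rank_le {h x : V} (hc : S.Canon h x) : S.R x ≤ S.R h :=
  hc.2 x (by simp [Setup.dist, wdist_self])

/-- Canonical pairs are closed under passing to a prefix of a shortest path. -/
theorem Setup.Canon.pred {h x u : V} (hc : S.Canon h x) (hu : S.G.Adj u x)
    (hd : S.dist h u + S.wt s(u, x) ≤ S.dist h x) : S.Canon h u := by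
  refine ⟨ne_top_of_le_ne_top hc.1 (le_self_add.trans hd), fun z hz => hc.2 z ?_⟩
  calc S.dist h z + S.dist z x ≤ S.dist h z + (S.dist z u + S.wt s(u, x)) :=
        add_le_add_right (wdist_adj_right z hu) _
    _ = (S.dist h z + S.dist z u) + S.wt s(u, x) := (add_assoc _ _ _).symm
    _ ≤ _ := (add_le_add_left hz _).trans hd

/-- The highest ranked vertex on the shortest paths between `x` and `y` forms canonical pairs with
both of them: the canonical labels are a 2-hop cover. -/
theorem Setup.exists_canon_canon {x y : V} (hxy : S.dist x y ≠ ⊤) :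
    ∃ h, S.Canon h x ∧ S.Canon h y ∧ S.dist x h + S.dist h y ≤ S.dist x y := by
  have hne : (Finset.univ.filter fun z => S.dist x z + S.dist z y ≤ S.dist x y).Nonempty :=
    ⟨x, by simp [Setup.dist, wdist_self]⟩
  obtain ⟨h, hh, hmax⟩ := Finset.exists_max_image _ S.R hne
  simp only [Finset.mem_filter, Finset.mem_univ, true_and] at hh hmax
  refine ⟨h, ⟨?_, fun z hz => hmax z ?_⟩, ⟨?_, fun z hz => hmax z ?_⟩, hh⟩
  · exact ne_top_of_le_ne_top hxy ((wdist_le_swap h x).trans (le_self_add.trans hh))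
  · calc S.dist x z + S.dist z y ≤ S.dist x z + (S.dist z h + S.dist h y) :=
          add_le_add_right (wdist_triangle z h y) _
      _ = (S.dist h z + S.dist z x) + S.dist h y := by
          rw [← add_assoc, Setup.dist, Setup.dist, wdist_comm x z, wdist_comm z h,
            add_comm (wdist _ _ z x)]
      _ ≤ S.dist h x + S.dist h y := add_le_add_left hz _
      _ ≤ S.dist x y := by rwa [Setup.dist, wdist_comm h x]
  · exact ne_top_of_le_ne_top hxy (le_add_self.trans hh)
  · calc S.dist x z + S.dist z y ≤ (S.dist x h + S.dist h z) + S.dist z y :=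
          add_le_add_left (wdist_triangle x h z) _
      _ = S.dist x h + (S.dist h z + S.dist z y) := add_assoc _ _ _
      _ ≤ S.dist x h + S.dist h y := add_le_add_right hz _
      _ ≤ S.dist x y := hh

end Canonical

/-! ### Pruned Dijkstra -/

section Dijkstra

variable {V : Type u} [Fintype V] {S : Setup V}

/-- Invariant of a Dijkstra run from `h` with tentative distances `δ` and queue `Q`, where `P` is
the set of popped vertices and `A ⊆ P` the set of those whose edges were relaxed. It covers PLaNT
(`A = P`) and the pruned Dijkstra of DGLL. -/
structure DijkstraInv (S : Setup V) (h : V) (δ : V → ℝ≥0∞) (Q P A : Finset V) : Prop where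
  subset : A ⊆ P
  not_popped : ∀ x ∈ Q, x ∉ P
  ne_top_iff : ∀ x, δ x ≠ ⊤ ↔ x ∈ P ∨ x ∈ Q
  root : δ h = 0
  relaxed : ∀ x ∈ A, ∀ y, S.G.Adj x y → δ y ≤ δ x + S.wt s(x, y)
  popped_le : ∀ x ∈ P, ∀ y ∈ Q, δ x ≤ δ y
  dist_le : ∀ x, S.dist h x ≤ δ x
  parent : ∀ x, δ x ≠ ⊤ → x = h ∨ ∃ u ∈ A, S.G.Adj u x

/-- Popped vertices that form a canonical pair with the root were relaxed at their true distance. -/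
def ExactOnCanon (S : Setup V) (h : V) (δ : V → ℝ≥0∞) (P A : Finset V) : Prop :=
  ∀ x ∈ P, S.Canon h x → x ∈ A ∧ δ x = S.dist h x

theorem DijkstraInv.init (h : V) :
    DijkstraInv S h (Function.update (fun _ => ⊤) h 0) {h} ∅ ∅ := by
  have key : ∀ x, Function.update (fun _ : V => (⊤ : ℝ≥0∞)) h 0 x ≠ ⊤ → x = h := by
    intro x hx
    by_contra hne
    simp [Function.update_of_ne hne] at hx
  refine ⟨by simp, by simp, fun x => ⟨fun hx => by simp [key x hx], ?_⟩, by simp, by simp, by simp,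
    fun x => ?_, fun x hx => Or.inl (key x hx)⟩
  · rintro (hx | hx)
    · simp at hx
    · simp [Finset.mem_singleton.1 hx]
  · by_cases hx : x = h
    · simp [hx, Setup.dist, wdist_self]
    · simp [Function.update_of_ne hx]

theorem Setup.relax_le (δ : V → ℝ≥0∞) (x y : V) : S.relax δ x y ≤ δ y := by
  unfold Setup.relax
  split_ifs
  · exact min_le_left _ _
  · exact le_rfl

theorem Setup.relax_self (δ : V → ℝ≥0∞) (x : V) : S.relax δ x x = δ x := by
  simp [Setup.relax]

theorem Setup.le_relax {δ : V → ℝ≥0∞} {x y : V} (hy : δ x ≤ δ y) : δ x ≤ S.relax δ x y := by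
  unfold Setup.relax
  split_ifs
  · exact le_min hy le_self_add
  · exact hy

theorem Setup.relax_of_le {δ : V → ℝ≥0∞} {x y : V} (hy : δ y ≤ δ x) : S.relax δ x y = δ y := by
  unfold Setup.relax
  split_ifs
  · exact min_eq_left (hy.trans le_self_add)
  · rfl

/-- Popping the head `x` of the queue without relaxing its edges. -/
theorem DijkstraInv.prune {h x : V} {δ : V → ℝ≥0∞} {Q P A : Finset V}
    (I : DijkstraInv S h δ Q P A) (hx : IsHead Q δ x) :
    DijkstraInv S h δ (Q.erase x) (insert x P) A where
  subset := I.subset.trans (Finset.subset_insert _ _)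
  not_popped y hy := by
    rw [Finset.mem_erase] at hy
    simpa [hy.1] using I.not_popped y hy.2
  ne_top_iff y := by
    rw [I.ne_top_iff]
    have := hx.1
    by_cases hyx : y = x
    · subst hyx; simp [this]
    · simp [hyx]
  root := I.root
  relaxed := I.relaxed
  popped_le y hy z hz := by
    rcases Finset.mem_insert.1 hy with rfl | hy
    · exact hx.2 z (Finset.mem_of_mem_erase hz)
    · exact I.popped_le y hy z (Finset.mem_of_mem_erase hz)
  dist_le := I.dist_le
  parent := I.parent

theorem DijkstraInv.popped_le_head {h x : V} {δ : V → ℝ≥0∞} {Q P A : Finset V}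
    (I : DijkstraInv S h δ Q P A) (hx : IsHead Q δ x) {y : V} (hy : y ∈ insert x P) :
    δ y ≤ δ x := by
  rcases Finset.mem_insert.1 hy with rfl | hy
  · exact le_rfl
  · exact I.popped_le y hy x hx.1

/-- Popping the head `x` of the queue and relaxing its edges. -/
theorem DijkstraInv.relax {h x : V} {δ : V → ℝ≥0∞} {Q P A : Finset V}
    (I : DijkstraInv S h δ Q P A) (hx : IsHead Q δ x) :
    DijkstraInv S h (S.relax δ x) (S.relaxQueue δ Q x) (insert x P) (insert x A) := by
  have htop : δ x ≠ ⊤ := (I.ne_top_iff x).2 (Or.inr hx.1)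
  have memQ : ∀ y, y ∈ S.relaxQueue δ Q x ↔
      (y ≠ x ∧ y ∈ Q) ∨ (S.G.Adj x y ∧ δ x + S.wt s(x, y) < δ y) := by
    intro y
    simp [Setup.relaxQueue]
  refine ⟨Finset.insert_subset_insert _ I.subset, ?_, ?_, ?_, ?_, ?_, ?_, ?_⟩
  · intro y hy hyP
    rcases (memQ y).1 hy with ⟨hyx, hyQ⟩ | ⟨hadj, hlt⟩
    · exact I.not_popped y hyQ ((Finset.mem_insert.1 hyP).resolve_left hyx)
    · exact absurd (I.popped_le_head hx hyP) (not_le.2 (lt_of_le_of_lt le_self_add hlt))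
  · intro y
    rw [memQ, Finset.mem_insert]
    by_cases hadj : S.G.Adj x y ∧ δ x + S.wt s(x, y) < δ y
    · refine iff_of_true ?_ (Or.inr (Or.inr hadj))
      rw [Setup.relax, if_pos hadj.1, min_eq_right hadj.2.le]
      exact hadj.2.ne_top
    · have heq : S.relax δ x y ≠ ⊤ ↔ δ y ≠ ⊤ := by
        unfold Setup.relax
        split_ifs with h1
        · rw [min_eq_left (not_lt.1 fun h2 => hadj ⟨h1, h2⟩)]
        · rfl
      rw [heq, I.ne_top_iff]
      have := hx.1
      by_cases hyx : y = x
      · subst hyx; simp [this]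
      · simp [hyx, hadj]
  · exact le_antisymm ((Setup.relax_le _ _ _).trans I.root.le) bot_le
  · intro z hz y hadj
    rcases Finset.mem_insert.1 hz with rfl | hzA
    · rw [Setup.relax_self, Setup.relax, if_pos hadj]
      exact min_le_right _ _
    · rw [Setup.relax_of_le (I.popped_le z (I.subset hzA) x hx.1)]
      exact (Setup.relax_le _ _ _).trans (I.relaxed z hzA y hadj)
  · intro z hz y hy
    have hzx := I.popped_le_head hx hz
    rw [Setup.relax_of_le hzx]
    refine hzx.trans (Setup.le_relax ?_)
    rcases (memQ y).1 hy with ⟨_, hyQ⟩ | ⟨_, hlt⟩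
    · exact hx.2 y hyQ
    · exact le_self_add.trans hlt.le
  · intro y
    unfold Setup.relax
    split_ifs with hadj
    · exact le_min (I.dist_le y)
        ((wdist_adj_right h hadj).trans (add_le_add_left (I.dist_le x) _))
    · exact I.dist_le y
  · intro y hy
    by_cases hadj : S.G.Adj x y
    · exact Or.inr ⟨x, Finset.mem_insert_self _ _, hadj⟩
    · rw [Setup.relax, if_neg hadj] at hy
      exact (I.parent y hy).imp_right fun ⟨u, hu, huy⟩ => ⟨u, Finset.mem_insert_of_mem hu, huy⟩

/-- The first unpopped vertex on a shortest path to an unpopped canonical vertex is in the queue,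
with its true distance. -/
theorem DijkstraInv.exists_mem_queue (hpos : ∀ e ∈ S.G.edgeSet, 0 < S.wt e) {h : V}
    {δ : V → ℝ≥0∞} {Q P A : Finset V} (I : DijkstraInv S h δ Q P A) (E : ExactOnCanon S h δ P A)
    (y : V) (hy : S.Canon h y) (hyP : y ∉ P) :
    ∃ z ∈ Q, S.Canon h z ∧ δ z = S.dist h z ∧ S.dist h z ≤ S.dist h y := by
  have wf : WellFounded fun a b : V => S.dist h a < S.dist h b :=
    Finite.wellFounded_of_trans_of_irrefl _ 
  induction y using wf.induction with
  | _ y ih =>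
  by_cases hyh : y = h
  · subst hyh
    have hQ : y ∈ Q := ((I.ne_top_iff y).1 (by simp [I.root])).resolve_left hyP
    exact ⟨y, hQ, hy, by simp [I.root, Setup.dist, wdist_self], le_rfl⟩
  · obtain ⟨u, hadj, hu⟩ := exists_adj_wdist_add_le hyh hy.1
    have hcu := hy.pred hadj hu
    by_cases huP : u ∈ P
    · obtain ⟨huA, hδu⟩ := E u huP hcu
      have hle : δ y ≤ S.dist h y := (I.relaxed u huA y hadj).trans (hδu ▸ hu)
      have hQ : y ∈ Q :=
        ((I.ne_top_iff y).1 (ne_top_of_le_ne_top hy.1 hle)).resolve_left hyP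
      exact ⟨y, hQ, hy, le_antisymm hle (I.dist_le y), le_rfl⟩
    · have hlt : S.dist h u < S.dist h y := by
        refine lt_of_lt_of_le (ENNReal.lt_add_right hcu.1 ?_) hu
        exact_mod_cast (hpos _ ((SimpleGraph.mem_edgeSet _).2 hadj)).ne'
      obtain ⟨z, hz, hcz, hδ, hle⟩ := ih u hlt hcu huP
      exact ⟨z, hz, hcz, hδ, hle.trans hlt.le⟩

/-- The head of the queue has its true distance if it forms a canonical pair with the root. -/
theorem DijkstraInv.head_eq (hpos : ∀ e ∈ S.G.edgeSet, 0 < S.wt e) {h x : V}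
    {δ : V → ℝ≥0∞} {Q P A : Finset V} (I : DijkstraInv S h δ Q P A) (E : ExactOnCanon S h δ P A)
    (hx : IsHead Q δ x) (hc : S.Canon h x) : δ x = S.dist h x := by
  obtain ⟨z, hz, -, hδ, hle⟩ := I.exists_mem_queue hpos E x hc (I.not_popped x hx.1)
  exact le_antisymm ((hx.2 z hz).trans (hδ.le.trans hle)) (I.dist_le x)

theorem ExactOnCanon.prune {h x : V} {δ : V → ℝ≥0∞} {P A : Finset V}
    (E : ExactOnCanon S h δ P A) (hc : ¬ S.Canon h x) : ExactOnCanon S h δ (insert x P) A := by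
  intro y hy hcy
  rcases Finset.mem_insert.1 hy with rfl | hy
  · exact absurd hcy hc
  · exact E y hy hcy

theorem ExactOnCanon.relax (hpos : ∀ e ∈ S.G.edgeSet, 0 < S.wt e) {h x : V} {δ : V → ℝ≥0∞}
    {Q P A : Finset V} (I : DijkstraInv S h δ Q P A) (E : ExactOnCanon S h δ P A)
    (hx : IsHead Q δ x) : ExactOnCanon S h (S.relax δ x) (insert x P) (insert x A) := by
  intro y hy hcy
  rw [Setup.relax_of_le (I.popped_le_head hx hy)]
  rcases Finset.mem_insert.1 hy with rfl | hy
  · exact ⟨Finset.mem_insert_self _ _, I.head_eq hpos E hx hcy⟩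
  · exact ⟨Finset.mem_insert_of_mem (E y hy hcy).1, (E y hy hcy).2⟩

/-- The degree of `x`. -/
def Setup.deg (S : Setup V) (x : V) : ℕ := (S.G.neighborSet x).ncard

/-- All vertices reached by a Dijkstra run, popped or not, are its root and neighbours of relaxed
vertices. -/
theorem DijkstraInv.touched_le {h : V} {δ : V → ℝ≥0∞} {Q P A : Finset V}
    (I : DijkstraInv S h δ Q P A) : touched δ ≤ 1 + ∑ x ∈ A, S.deg x := by
  have hsub : (Finset.univ.filter fun x => δ x ≠ ⊤) ⊆
      insert h (A.biUnion fun x => (S.G.neighborSet x).toFinset) := by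
    intro x hx
    rcases I.parent x (Finset.mem_filter.1 hx).2 with rfl | ⟨u, hu, hux⟩
    · exact Finset.mem_insert_self _ _
    · exact Finset.mem_insert_of_mem (Finset.mem_biUnion.2 ⟨u, hu, by simpa using hux⟩)
  refine (Finset.card_le_card hsub).trans ((Finset.card_insert_le _ _).trans ?_)
  rw [add_comm]
  refine add_le_add_right (Finset.card_biUnion_le.trans (Finset.sum_le_sum fun x _ => ?_)) _
  rw [Setup.deg, Set.ncard_eq_toFinset_card']

theorem DijkstraInv.card_popped_le {h : V} {δ : V → ℝ≥0∞} {Q P A : Finset V}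
    (I : DijkstraInv S h δ Q P A) : P.card ≤ touched δ :=
  Finset.card_le_card fun x hx => Finset.mem_filter.2
    ⟨Finset.mem_univ x, (I.ne_top_iff x).2 (Or.inl hx)⟩

end Dijkstra

/-! ### The shortest path tree of a single root -/

section Tree

variable {V : Type u} [Fintype V] {S : Setup V}

theorem Setup.le_higher_left (x y : V) : S.R x ≤ S.R (S.higher x y) := by
  unfold Setup.higher
  split_ifs with h
  · exact h.le
  · exact le_rfl

theorem Setup.le_higher_right (x y : V) : S.R y ≤ S.R (S.higher x y) := by
  unfold Setup.higher
  split_ifs with h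
  · exact le_rfl
  · exact not_lt.1 h

theorem Setup.higher_induction {p : V → Prop} {x y : V} (hx : p x) (hy : p y) :
    p (S.higher x y) := by
  unfold Setup.higher
  split_ifs
  · exact hy
  · exact hx

/-- The recorded ancestor of a reached vertex `y` lies on a walk from `h` to `y` of at most the
tentative length, and is ranked at least as high as `h`. -/
def AncInv (S : Setup V) (h : V) (t : PlantTree V) : Prop :=
  ∀ y, t.dist y ≠ ⊤ →
    S.dist h (t.anc y) + S.dist (t.anc y) y ≤ t.dist y ∧ S.R h ≤ S.R (t.anc y)

theorem AncInv.init (h : V) : AncInv S h (PlantTree.init h) := by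
  intro y hy
  have : y = h := by
    by_contra hne
    simp [PlantTree.init, Function.update_of_ne hne] at hy
  subst this
  simp [PlantTree.init, Setup.dist, wdist_self]

theorem AncInv.iter {h x : V} {t : PlantTree V} {P A : Finset V} (I : AncInv S h t)
    (D : DijkstraInv S h t.dist t.queue P A) (hx : IsHead t.queue t.dist x) :
    AncInv S h (S.plantIter t x) := by
  have htop : t.dist x ≠ ⊤ := (D.ne_top_iff x).2 (Or.inr hx.1)
  intro y hy
  have hdist : S.dist h y + S.dist y y ≤ (S.plantIter t x).dist y := by
    rw [show S.dist y y = 0 from wdist_self y, add_zero]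
    exact (D.relax hx).dist_le y
  by_cases hadj : S.G.Adj x y
  · have hstep : ∀ z, S.dist h z + S.dist z x ≤ t.dist x →
        S.dist h z + S.dist z y ≤ t.dist x + S.wt s(x, y) := fun z hz =>
      calc S.dist h z + S.dist z y ≤ S.dist h z + (S.dist z x + S.wt s(x, y)) :=
            add_le_add_right (wdist_adj_right z hadj) _
        _ = (S.dist h z + S.dist z x) + S.wt s(x, y) := (add_assoc _ _ _).symm
        _ ≤ _ := add_le_add_left hz _
    have hTop : S.dist h (S.topAnc t x) + S.dist (S.topAnc t x) y ≤
        t.dist x + S.wt s(x, y) :=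
      hstep _ (Setup.higher_induction (p := fun z => S.dist h z + S.dist z x ≤ t.dist x)
        (by simpa [Setup.dist, wdist_self] using D.dist_le x) (I x htop).1)
    have hR : S.R h ≤ S.R (S.topAnc t x) := (I x htop).2.trans (Setup.le_higher_right _ _)
    rcases lt_trichotomy (t.dist x + S.wt s(x, y)) (t.dist y) with hlt | heq | hgt
    · have hd : (S.plantIter t x).dist y = t.dist x + S.wt s(x, y) := by
        simp [Setup.plantIter, Setup.relax, hadj, hlt.le]
      have ha : (S.plantIter t x).anc y = S.higher (S.topAnc t x) y := by
        simp [Setup.plantIter, hadj, hlt]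
      rw [ha]
      refine ⟨Setup.higher_induction
        (p := fun z => S.dist h z + S.dist z y ≤ (S.plantIter t x).dist y) ?_ hdist,
        hR.trans (Setup.le_higher_left _ _)⟩
      rwa [hd]
    · have hd : (S.plantIter t x).dist y = t.dist y := by
        simp [Setup.plantIter, Setup.relax, hadj, heq]
      have ha : (S.plantIter t x).anc y = S.higher (S.topAnc t x) (t.anc y) := by
        simp [Setup.plantIter, hadj, heq]
      rw [ha]
      refine ⟨Setup.higher_induction
        (p := fun z => S.dist h z + S.dist z y ≤ (S.plantIter t x).dist y) ?_ ?_,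
        hR.trans (Setup.le_higher_left _ _)⟩
      · rwa [hd, ← heq]
      · rw [hd]
        exact (I y (hd ▸ hy)).1
    · have hd : (S.plantIter t x).dist y = t.dist y := by
        simp [Setup.plantIter, Setup.relax, hadj, hgt.le]
      have ha : (S.plantIter t x).anc y = t.anc y := by
        simp [Setup.plantIter, hadj, hgt.not_gt, hgt.ne']
      rw [ha, hd]
      exact I y (hd ▸ hy)
  · have hd : (S.plantIter t x).dist y = t.dist y := by
      simp [Setup.plantIter, Setup.relax, hadj]
    have ha : (S.plantIter t x).anc y = t.anc y := by
      simp [Setup.plantIter, hadj]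
    rw [ha, hd]
    exact I y (hd ▸ hy)

/-- `x` can be reached from `h` by a walk on which no vertex is ranked higher than `h`. Only such
`x` are relaxed in the pruned tree of `h`. -/
def Setup.LowReach (S : Setup V) (h x : V) : Prop :=
  Relation.ReflTransGen (fun a b => S.G.Adj a b ∧ S.R b ≤ S.R h) h x

/-- History of the tree of a root: the vertices popped and relaxed so far, and the number of steps
spent on it. -/
structure History (V : Type u) where
  popped : Finset V
  relaxed : Finset V
  cost : ℕ

/-- Bound on the work of one planted tree. -/
def Setup.plantBudget (S : Setup V) : ℕ :=
  2 + Fintype.card V + ∑ x, (2 + Setup.heapCost (V := V) + S.scanCost x)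

/-- Bound on the work of the pruned tree of `h` when no vertex has more than `M` labels. -/
def Setup.gllBudget (S : Setup V) (M : ℕ) (h : V) : ℕ :=
  4 + Setup.heapCost (V := V) + M + ∑ x ∈ Finset.univ.filter (S.LowReach h),
    (M + S.deg x * (2 + Setup.heapCost (V := V)) + 1 + S.scanCost x)

/-- Invariant of a planted tree. -/
structure PlantInv (S : Setup V) (h : V) (t : PlantTree V) (g : History V) : Prop where
  phase : S.treeId h < S.k
  relaxed_eq : g.relaxed = g.popped
  dijkstra : DijkstraInv S h t.dist t.queue g.popped g.relaxed
  exact_on_canon : ExactOnCanon S h t.dist g.popped g.relaxed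
  anc : AncInv S h t
  cost_le : g.cost ≤ 1 + ∑ x ∈ g.popped, (2 + Setup.heapCost (V := V) + S.scanCost x)

/-- Invariant of a pruned tree; `LR` holds labels of the root with hubs other than the root. -/
structure GllInv (S : Setup V) (M : ℕ) (h : V) (t : GllTree V) (g : History V) : Prop where
  phase : S.k ≤ S.treeId h
  dijkstra : DijkstraInv S h t.dist t.queue g.popped g.relaxed
  exact_on_canon : ExactOnCanon S h t.dist g.popped g.relaxed
  rootLabels : ∀ b ∈ t.LR, b.hub ≠ h ∧ S.R h ≤ S.R b.hub ∧ S.dist h b.hub ≤ b.d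
  low : ∀ x ∈ g.relaxed, S.LowReach h x
  cost_le : g.cost ≤ 1 + M + g.popped.card * (1 + Setup.heapCost (V := V)) +
    (g.popped.filter fun x => S.R x ≤ S.R h).card * M + ∑ x ∈ g.relaxed, (1 + S.scanCost x)

/-- What is known about a completed tree. -/
structure DoneInv (S : Setup V) (M : ℕ) (h : V) (g : History V) : Prop where
  canon : ∀ x, S.Canon h x → x ∈ g.popped
  low : S.k ≤ S.treeId h → ∀ x ∈ g.relaxed, S.LowReach h x
  cost_le : g.cost ≤ if S.treeId h < S.k then S.plantBudget else S.gllBudget M h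

/-- Invariant of the tree of `h`, depending on its status. -/
def TreeInv (S : Setup V) (M : ℕ) (h : V) : Status V → History V → Prop
  | .waiting, g => g.popped = ∅ ∧ g.relaxed = ∅ ∧ g.cost = 0
  | .plant t, g => PlantInv S h t g
  | .gll t, g => GllInv S M h t g
  | .done, g => DoneInv S M h g

theorem PlantInv.init {h : V} (hk : S.treeId h < S.k) :
    PlantInv S h (PlantTree.init h) ⟨∅, ∅, 1⟩ where
  phase := hk
  relaxed_eq := rfl
  dijkstra := DijkstraInv.init h
  exact_on_canon := by simp [ExactOnCanon]
  anc := AncInv.init h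
  cost_le := by simp

theorem Setup.card_plantLabel_le (t : PlantTree V) (h x : V) : (S.plantLabel t h x).card ≤ 1 := by
  unfold Setup.plantLabel
  split_ifs <;> simp

theorem PlantInv.iter (hpos : ∀ e ∈ S.G.edgeSet, 0 < S.wt e) {h x : V} {t : PlantTree V}
    {g : History V} (I : PlantInv S h t g) (hx : IsHead t.queue t.dist x) :
    PlantInv S h (S.plantIter t x) ⟨insert x g.popped, insert x g.relaxed, g.cost +
      (1 + Setup.heapCost (V := V) + (S.plantLabel t h x).card + S.scanCost x)⟩ where
  phase := I.phase
  relaxed_eq := by rw [I.relaxed_eq]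
  dijkstra := I.dijkstra.relax hx
  exact_on_canon := I.exact_on_canon.relax hpos I.dijkstra hx
  anc := I.anc.iter I.dijkstra hx
  cost_le := by
    rw [Finset.sum_insert (I.dijkstra.not_popped x hx.1)]
    have := I.cost_le
    have := S.card_plantLabel_le t h x
    dsimp only
    omega

/-- PLaNT generates the labels of all popped canonical vertices. -/
theorem PlantInv.mem_plantLabel (hpos : ∀ e ∈ S.G.edgeSet, 0 < S.wt e) {h x : V} {t : PlantTree V}
    {g : History V} (I : PlantInv S h t g) (hx : IsHead t.queue t.dist x) (hc : S.Canon h x) :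
    t.dist x = S.dist h x ∧ ⟨x, h, t.dist x⟩ ∈ S.plantLabel t h x := by
  have hd := I.dijkstra.head_eq hpos I.exact_on_canon hx hc
  refine ⟨hd, ?_⟩
  have hanc := (I.anc x ((I.dijkstra.ne_top_iff x).2 (Or.inr hx.1))).1
  have hR : S.R (S.topAnc t x) ≤ S.R h :=
    Setup.higher_induction (p := fun z => S.R z ≤ S.R h) hc.rank_le (hc.2 _ (hd ▸ hanc))
  simp [Setup.plantLabel, not_lt.2 hR]

/-- Early termination of PLaNT loses no canonical label. -/
theorem PlantInv.canon_mem_of_dead (hpos : ∀ e ∈ S.G.edgeSet, 0 < S.wt e) {h : V}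
    {t : PlantTree V} {g : History V} (I : PlantInv S h t g) (dead : ∀ y ∈ t.queue, t.anc y ≠ h)
    {x : V} (hc : S.Canon h x) : x ∈ g.popped := by
  by_contra hxP
  obtain ⟨z, hz, hcz, hδ, -⟩ := I.dijkstra.exists_mem_queue hpos I.exact_on_canon x hc hxP
  have hanc := I.anc z ((I.dijkstra.ne_top_iff z).2 (Or.inr hz))
  exact dead z hz (S.R.injective (le_antisymm (hcz.2 _ (hδ ▸ hanc.1)) hanc.2))

theorem PlantInv.cost_add_le {h : V} {t : PlantTree V} {g : History V} (I : PlantInv S h t g) :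
    g.cost + (1 + touched t.dist) ≤ S.plantBudget := by
  have h1 := I.cost_le
  have h2 : touched t.dist ≤ Fintype.card V := Finset.card_le_univ _
  have h3 : ∑ x ∈ g.popped, (2 + Setup.heapCost (V := V) + S.scanCost x) ≤
      ∑ x, (2 + Setup.heapCost (V := V) + S.scanCost x) :=
    Finset.sum_le_univ_sum_of_nonneg fun _ => Nat.zero_le _
  unfold Setup.plantBudget
  omega

theorem PlantInv.finish (hpos : ∀ e ∈ S.G.edgeSet, 0 < S.wt e) (M : ℕ) {h : V} {t : PlantTree V}
    {g : History V} (I : PlantInv S h t g) (dead : ∀ y ∈ t.queue, t.anc y ≠ h) :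
    DoneInv S M h ⟨g.popped, g.relaxed, g.cost + (1 + touched t.dist)⟩ where
  canon _ hc := I.canon_mem_of_dead hpos dead hc
  low hk := absurd I.phase (not_lt.2 hk)
  cost_le := by
    rw [if_pos I.phase]
    exact I.cost_add_le

theorem GllInv.init {M : ℕ} {h : V} (hk : S.k ≤ S.treeId h) {LR : Finset (Label V)}
    (hLR : ∀ b ∈ LR, b.hub ≠ h ∧ S.R h ≤ S.R b.hub ∧ S.dist h b.hub ≤ b.d) (hM : LR.card ≤ M) :
    GllInv S M h (GllTree.init h LR) ⟨∅, ∅, 1 + LR.card⟩ where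
  phase := hk
  dijkstra := DijkstraInv.init h
  exact_on_canon := by simp [ExactOnCanon]
  rootLabels := hLR
  low := by simp
  cost_le := by simpa using hM

/-- A vertex that passes the rank query is reached through vertices that passed it. -/
theorem GllInv.lowReach {M : ℕ} {h x : V} {t : GllTree V} {g : History V} (I : GllInv S M h t g)
    (hx : t.dist x ≠ ⊤) (hR : S.R x ≤ S.R h) : S.LowReach h x := by
  rcases I.dijkstra.parent x hx with rfl | ⟨u, hu, hux⟩
  · exact Relation.ReflTransGen.refl
  · exact (I.low u hu).tail ⟨hux, hR⟩

/-- No label prunes a canonical vertex: the hub of such a label would lie on a shortest path and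
differ from `h`, hence be ranked lower than `h`, but hubs of labels of `h` are ranked higher. -/
theorem GllInv.accepts_of_canon {M : ℕ} (hpos : ∀ e ∈ S.G.edgeSet, 0 < S.wt e) {h x : V}
    {t : GllTree V} {g : History V} (I : GllInv S M h t g) (hx : IsHead t.queue t.dist x)
    {C : Config V} (hL : ∀ l ∈ C.glob ∪ C.loc, S.dist l.vertex l.hub ≤ l.d) (hc : S.Canon h x) :
    S.GllAccepts C t h x := by
  refine ⟨hc.rank_le, ?_⟩
  rintro ⟨a, ha, b, hb, hab, hle⟩
  rw [Setup.nodeLabels, labelsAt, Finset.mem_filter, Finset.mem_filter] at ha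
  have hb' := I.rootLabels b hb
  have ha' := hL a ha.1.1
  rw [ha.1.2, hab, Setup.dist, wdist_comm] at ha'
  refine hb'.1 (S.R.injective (le_antisymm (hc.2 _ ?_) hb'.2.1))
  rw [← I.dijkstra.head_eq hpos I.exact_on_canon hx hc]
  refine le_trans ?_ hle
  rw [add_comm]
  exact add_le_add ha' hb'.2.2

theorem GllInv.iter {M : ℕ} (hpos : ∀ e ∈ S.G.edgeSet, 0 < S.wt e) {h x : V}
    {t : GllTree V} {g : History V} (I : GllInv S M h t g) (hx : IsHead t.queue t.dist x)
    {C : Config V} (hL : ∀ l ∈ C.glob ∪ C.loc, S.dist l.vertex l.hub ≤ l.d)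
    (hM : (S.nodeLabels C h x).card ≤ M) :
    GllInv S M h (S.gllIter C t h x) ⟨insert x g.popped,
      if S.GllAccepts C t h x then insert x g.relaxed else g.relaxed,
      g.cost + S.gllCost C t h x⟩ := by
  have hxP := I.dijkstra.not_popped x hx.1
  have hxA : x ∉ g.relaxed := fun hxA => hxP (I.dijkstra.subset hxA)
  have hcost := I.cost_le
  have hfil : (g.popped.filter fun x => S.R x ≤ S.R h).card * M +
      (if S.R x ≤ S.R h then (S.nodeLabels C h x).card else 0) ≤
      ((insert x g.popped).filter fun x => S.R x ≤ S.R h).card * M := by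
    rw [Finset.filter_insert]
    split_ifs with hR
    · rw [Finset.card_insert_of_notMem (by simp [hxP]), add_mul, one_mul]
      exact Nat.add_le_add_left hM _
    · exact le_rfl
  have hcard : (insert x g.popped).card * (1 + Setup.heapCost (V := V)) =
      g.popped.card * (1 + Setup.heapCost (V := V)) + (1 + Setup.heapCost (V := V)) := by
    rw [Finset.card_insert_of_notMem hxP, add_mul, one_mul]
  have htop : t.dist x ≠ ⊤ := (I.dijkstra.ne_top_iff x).2 (Or.inr hx.1)
  by_cases hacc : S.GllAccepts C t h x
  · have hsum := Finset.sum_insert (f := fun x => 1 + S.scanCost x) hxA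
    refine ⟨I.phase, ?_, ?_, I.rootLabels, ?_, ?_⟩
    · simpa [Setup.gllIter, hacc] using I.dijkstra.relax hx
    · simpa [Setup.gllIter, hacc] using I.exact_on_canon.relax hpos I.dijkstra hx
    · intro y hy
      rw [if_pos hacc] at hy
      rcases Finset.mem_insert.1 hy with rfl | hy
      · exact I.lowReach htop hacc.1
      · exact I.low y hy
    · simp only [if_pos hacc, Setup.gllCost, hcard, hsum]
      omega
  · refine ⟨I.phase, ?_, ?_, I.rootLabels, ?_, ?_⟩
    · simpa [Setup.gllIter, hacc] using I.dijkstra.prune hx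
    · simpa [Setup.gllIter, hacc] using
        I.exact_on_canon.prune fun hc => hacc (I.accepts_of_canon hpos hx hL hc)
    · simpa [hacc] using I.low
    · simp only [if_neg hacc, Setup.gllCost, hcard]
      omega

theorem GllInv.cost_add_le {M : ℕ} {h : V} {t : GllTree V} {g : History V}
    (I : GllInv S M h t g) : g.cost + (1 + touched t.dist) ≤ S.gllBudget M h := by
  have h1 := I.cost_le
  have h2 := I.dijkstra.touched_le
  have h3 := I.dijkstra.card_popped_le
  have hsub : (g.popped.filter fun x => S.R x ≤ S.R h) ⊆ Finset.univ.filter (S.LowReach h) := by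
    intro x hx
    rw [Finset.mem_filter] at hx
    exact Finset.mem_filter.2 ⟨Finset.mem_univ x,
      I.lowReach ((I.dijkstra.ne_top_iff x).2 (Or.inl hx.1)) hx.2⟩
  have hsub' : g.relaxed ⊆ Finset.univ.filter (S.LowReach h) := fun x hx =>
    Finset.mem_filter.2 ⟨Finset.mem_univ x, I.low x hx⟩
  have h4 := Nat.mul_le_mul_right M (Finset.card_le_card hsub)
  have h5 : ∑ x ∈ g.relaxed, (S.deg x * (2 + Setup.heapCost (V := V)) + 1 + S.scanCost x) ≤
      ∑ x ∈ Finset.univ.filter (S.LowReach h),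
        (S.deg x * (2 + Setup.heapCost (V := V)) + 1 + S.scanCost x) :=
    Finset.sum_le_sum_of_subset hsub'
  have h6 : ∑ x ∈ Finset.univ.filter (S.LowReach h),
      (M + S.deg x * (2 + Setup.heapCost (V := V)) + 1 + S.scanCost x) =
      (Finset.univ.filter (S.LowReach h)).card * M + ∑ x ∈ Finset.univ.filter (S.LowReach h),
        (S.deg x * (2 + Setup.heapCost (V := V)) + 1 + S.scanCost x) := by
    rw [Finset.card_eq_sum_ones, Finset.sum_mul, ← Finset.sum_add_distrib]
    exact Finset.sum_congr rfl fun x _ => by ring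
  have h7 : ∑ x ∈ g.relaxed, (S.deg x * (2 + Setup.heapCost (V := V)) + 1 + S.scanCost x) =
      (∑ x ∈ g.relaxed, S.deg x) * (2 + Setup.heapCost (V := V)) +
        ∑ x ∈ g.relaxed, (1 + S.scanCost x) := by
    rw [Finset.sum_mul, ← Finset.sum_add_distrib]
    exact Finset.sum_congr rfl fun x _ => by ring
  have h8 : g.popped.card * (1 + Setup.heapCost (V := V)) + touched t.dist ≤
      (1 + ∑ x ∈ g.relaxed, S.deg x) * (2 + Setup.heapCost (V := V)) := by
    calc g.popped.card * (1 + Setup.heapCost (V := V)) + touched t.dist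
        ≤ touched t.dist * (1 + Setup.heapCost (V := V)) + touched t.dist :=
          Nat.add_le_add_right (Nat.mul_le_mul_right _ h3) _
      _ = touched t.dist * (2 + Setup.heapCost (V := V)) := by ring
      _ ≤ _ := Nat.mul_le_mul_right _ h2
  rw [add_mul, one_mul] at h8
  unfold Setup.gllBudget
  omega

theorem GllInv.finish {M : ℕ} (hpos : ∀ e ∈ S.G.edgeSet, 0 < S.wt e) {h : V} {t : GllTree V}
    {g : History V} (I : GllInv S M h t g) (hQ : t.queue = ∅) :
    DoneInv S M h ⟨g.popped, g.relaxed, g.cost + (1 + touched t.dist)⟩ where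
  canon x hc := by
    by_contra hxP
    obtain ⟨z, hz, -⟩ := I.dijkstra.exists_mem_queue hpos I.exact_on_canon x hc hxP
    simp [hQ] at hz
  low _ := I.low
  cost_le := by
    rw [if_neg (not_lt.2 I.phase)]
    exact I.cost_add_le

theorem TreeInv.low {M : ℕ} {h x : V} {st : Status V} {g : History V} (I : TreeInv S M h st g)
    (hk : S.k ≤ S.treeId h) (hx : x ∈ g.relaxed) : S.LowReach h x := by
  cases st with
  | waiting => simp [I.2.1] at hx
  | plant t => exact absurd (PlantInv.phase I) (not_lt.2 hk)
  | gll t => exact GllInv.low I x hx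
  | done => exact DoneInv.low I hk x hx

theorem TreeInv.cost_le {M : ℕ} {h : V} {st : Status V} {g : History V}
    (I : TreeInv S M h st g) :
    g.cost ≤ if S.treeId h < S.k then S.plantBudget else S.gllBudget M h := by
  cases st with
  | waiting => simp [I.2.2]
  | plant t =>
    rw [if_pos (PlantInv.phase I)]
    exact (Nat.le_add_right _ _).trans (PlantInv.cost_add_le I)
  | gll t =>
    rw [if_neg (not_lt.2 (GllInv.phase I))]
    exact (Nat.le_add_right _ _).trans (GllInv.cost_add_le I)
  | done => exact DoneInv.cost_le I

end Tree

/-! ### Label tables -/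

section Table

variable {V : Type u} [Fintype V] {S : Setup V}

/-- Invariant of the set `L` of all stored labels: labels come from relaxed vertices, there is at
most one for each vertex and hub, distances are never too small, and labels of popped canonical
vertices are present with their true distance. -/
structure TableInv (S : Setup V) (L : Finset (Label V)) (g : V → History V) : Prop where
  mem_relaxed : ∀ l ∈ L, l.vertex ∈ (g l.hub).relaxed
  rank_le : ∀ l ∈ L, S.R l.vertex ≤ S.R l.hub
  dist_le : ∀ l ∈ L, S.dist l.vertex l.hub ≤ l.d
  unique : ∀ l ∈ L, ∀ l' ∈ L, l.vertex = l'.vertex → l.hub = l'.hub → l = l'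
  canon : ∀ h x, S.Canon h x → x ∈ (g h).popped → ⟨x, h, S.dist h x⟩ ∈ L

/-- The table after a vertex `x` was popped in the tree of `h`, which generated the labels `N`. -/
theorem TableInv.insert {L N : Finset (Label V)} {g : V → History V} (I : TableInv S L g)
    {h x : V} {δ : ℝ≥0∞} {A : Finset V} (c : ℕ) (hxA : x ∉ (g h).relaxed)
    (hA : (g h).relaxed ⊆ A)
    (hN : ∀ l ∈ N, l = ⟨x, h, δ⟩ ∧ x ∈ A ∧ S.R x ≤ S.R h) (hδ : S.dist h x ≤ δ)
    (hc : S.Canon h x → δ = S.dist h x ∧ ⟨x, h, δ⟩ ∈ N) :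
    TableInv S (L ∪ N) (Function.update g h ⟨Insert.insert x (g h).popped, A, c⟩) where
  mem_relaxed l hl := by
    rcases Finset.mem_union.1 hl with hl | hl
    · by_cases hh : l.hub = h
      · rw [hh, Function.update_self]
        exact hA (hh ▸ I.mem_relaxed l hl)
      · rw [Function.update_of_ne hh]
        exact I.mem_relaxed l hl
    · obtain ⟨rfl, hx, -⟩ := hN l hl
      simpa using hx
  rank_le l hl := by
    rcases Finset.mem_union.1 hl with hl | hl
    · exact I.rank_le l hl
    · obtain ⟨rfl, -, hR⟩ := hN l hl
      exact hR
  dist_le l hl := by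
    rcases Finset.mem_union.1 hl with hl | hl
    · exact I.dist_le l hl
    · obtain ⟨rfl, -, -⟩ := hN l hl
      exact (wdist_le_swap x h).trans hδ
  unique l hl l' hl' hv hh := by
    have new : ∀ l ∈ L, ∀ l' ∈ N, l.vertex = l'.vertex → l.hub = l'.hub → l = l' := by
      intro l hl l' hl' hv hh
      obtain ⟨rfl, -, -⟩ := hN l' hl'
      have := I.mem_relaxed l hl
      rw [hv, hh] at this
      exact absurd this hxA
    rcases Finset.mem_union.1 hl with hl | hl <;> rcases Finset.mem_union.1 hl' with hl' | hl'
    · exact I.unique l hl l' hl' hv hh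
    · exact new l hl l' hl' hv hh
    · exact (new l' hl' l hl hv.symm hh.symm).symm
    · rw [(hN l hl).1, (hN l' hl').1]
  canon h' y hcy hy := by
    by_cases hh : h' = h
    · subst hh
      rw [Function.update_self] at hy
      rcases Finset.mem_insert.1 hy with rfl | hy
      · obtain ⟨hd, hmem⟩ := hc hcy
        exact Finset.mem_union_right _ (hd ▸ hmem)
      · exact Finset.mem_union_left _ (I.canon _ y hcy hy)
    · rw [Function.update_of_ne hh] at hy
      exact Finset.mem_union_left _ (I.canon h' y hcy hy)

theorem TableInv.update_cost {L : Finset (Label V)} {g : V → History V} (I : TableInv S L g)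
    {h : V} {γ : History V} (hp : γ.popped = (g h).popped) (hr : γ.relaxed = (g h).relaxed) :
    TableInv S L (Function.update g h γ) := by
  have hp' : ∀ h', (Function.update g h γ h').popped = (g h').popped := by
    intro h'
    by_cases hh : h' = h
    · subst hh; simpa using hp
    · simp [Function.update_of_ne hh]
  have hr' : ∀ h', (Function.update g h γ h').relaxed = (g h').relaxed := by
    intro h'
    by_cases hh : h' = h
    · subst hh; simpa using hr
    · simp [Function.update_of_ne hh]
  exact ⟨fun l hl => (hr' _).symm ▸ I.mem_relaxed l hl, I.rank_le, I.dist_le, I.unique,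
    fun h' x hc hx => I.canon h' x hc (hp' h' ▸ hx)⟩

/-- Cleaning never deletes the label of a canonical pair. -/
theorem TableInv.not_redundant {L : Finset (Label V)} {g : V → History V} (I : TableInv S L g)
    {h x : V} (hc : S.Canon h x) : ¬ S.Redundant L ⟨x, h, S.dist h x⟩ := by
  rintro ⟨a, ha, b, hb, hab, hle, hlt⟩
  rw [labelsAt, Finset.mem_filter] at ha hb
  have ha' := I.dist_le a ha.1
  have hb' := I.dist_le b hb.1
  rw [ha.2, Setup.dist, wdist_comm] at ha'
  rw [hb.2, ← hab] at hb'
  refine absurd (hc.2 a.hub ?_) (not_le.2 hlt)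
  rw [add_comm]
  exact (add_le_add ha' hb').trans hle

theorem TableInv.clean {G N : Finset (Label V)} {g : V → History V} (I : TableInv S (G ∪ N) g) :
    TableInv S (G ∪ N.filter fun l => ¬ S.Redundant (G ∪ N) l) g := by
  have hsub : G ∪ (N.filter fun l => ¬ S.Redundant (G ∪ N) l) ⊆ G ∪ N :=
    Finset.union_subset_union_right (Finset.filter_subset _ _)
  refine ⟨fun l hl => I.mem_relaxed l (hsub hl), fun l hl => I.rank_le l (hsub hl),
    fun l hl => I.dist_le l (hsub hl), fun l hl l' hl' => I.unique l (hsub hl) l' (hsub hl'), ?_⟩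
  intro h x hc hx
  rcases Finset.mem_union.1 (I.canon h x hc hx) with hl | hl
  · exact Finset.mem_union_left _ hl
  · exact Finset.mem_union_right _ (Finset.mem_filter.2 ⟨hl, I.not_redundant hc⟩)

theorem Setup.treeId_injective : Function.Injective S.treeId := fun _ _ hxy =>
  S.R.injective (Fin.rev_injective (Fin.ext hxy))

theorem Setup.treeId_lt (h : V) : S.treeId h < Fintype.card V := (S.R h).rev.isLt

theorem Setup.card_treeId_lt_le (k : ℕ) :
    (Finset.univ.filter fun h => S.treeId h < k).card ≤ k := by
  calc _ ≤ (Finset.range k).card := Finset.card_le_card_of_injOn S.treeId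
        (fun h hh => by simpa using hh) (Setup.treeId_injective.injOn)
    _ = k := Finset.card_range k

/-- `B` bounds, for every vertex, the number of hubs outside the `k` highest ranked vertices from
which it can be reached through vertices ranked below the hub. -/
def Setup.HubBound (S : Setup V) (B : ℕ) : Prop :=
  ∀ x, (Finset.univ.filter fun h => S.k ≤ S.treeId h ∧ S.LowReach h x).card ≤ B

theorem TableInv.card_labelsAt_le {B : ℕ} (hB : S.HubBound B) {L : Finset (Label V)}
    {g : V → History V} (I : TableInv S L g)
    (low : ∀ h x, S.k ≤ S.treeId h → x ∈ (g h).relaxed → S.LowReach h x) (x : V) :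
    (labelsAt L x).card ≤ S.k + B := by
  calc (labelsAt L x).card
      ≤ ((Finset.univ.filter fun h => S.treeId h < S.k) ∪
          Finset.univ.filter fun h => S.k ≤ S.treeId h ∧ S.LowReach h x).card := by
        refine Finset.card_le_card_of_injOn Label.hub (fun l hl => ?_) fun l hl l' hl' hh => ?_
        · rw [labelsAt, Finset.mem_coe, Finset.mem_filter] at hl
          have hm := I.mem_relaxed l hl.1
          rw [hl.2] at hm
          rcases lt_or_ge (S.treeId l.hub) S.k with hk | hk
          · simp [hk]
          · simp [hk, low _ _ hk hm]
        · rw [labelsAt, Finset.mem_coe, Finset.mem_filter] at hl hl'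
          exact I.unique l hl.1 l' hl'.1 (hl.2.trans hl'.2.symm) hh
    _ ≤ _ := (Finset.card_union_le _ _).trans (add_le_add (Setup.card_treeId_lt_le _) (hB x))

theorem card_nodeLabels_le (C : Config V) (h x : V) :
    (S.nodeLabels C h x).card ≤ (labelsAt (C.glob ∪ C.loc) x).card :=
  Finset.card_le_card (Finset.filter_subset _ _)

/-- A set of labels with at most one label for each vertex and hub, all hubs being in `H`. -/
theorem card_labels_le {L : Finset (Label V)} (H : Finset V) (hH : ∀ l ∈ L, l.hub ∈ H)
    (unique : ∀ l ∈ L, ∀ l' ∈ L, l.vertex = l'.vertex → l.hub = l'.hub → l = l') :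
    L.card ≤ Fintype.card V * H.card := by
  calc L.card ≤ ((Finset.univ : Finset V) ×ˢ H).card :=
        Finset.card_le_card_of_injOn (fun l => (l.vertex, l.hub))
          (fun l hl => by simpa using hH l hl)
          fun l hl l' hl' hh => unique l hl l' hl' (congrArg Prod.fst hh) (congrArg Prod.snd hh)
    _ = _ := by rw [Finset.card_product, Finset.card_univ]

end Table

/-! ### Executions of the algorithm -/

section Global

theorem sum_update_eq {ι α : Type*} {s : Finset ι} {h : ι} (hh : h ∈ s) (F : α → ℕ) (g : ι → α)
    (γ : α) {c : ℕ} (hγ : F γ = F (g h) + c) :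
    ∑ h' ∈ s, F (Function.update g h γ h') = ∑ h' ∈ s, F (g h') + c := by
  rw [← Finset.add_sum_erase _ _ hh, ← Finset.add_sum_erase s (fun h' => F (g h')) hh,
    Function.update_self, hγ, Finset.sum_congr rfl fun h' hh' => by
      rw [Function.update_of_ne (Finset.ne_of_mem_erase hh')]]
  ring

variable {V : Type u} [Fintype V] {S : Setup V}

theorem Setup.first_mono : Monotone S.first := by
  refine monotone_nat_of_le_succ fun j => ?_
  cases j with
  | zero => exact Nat.zero_le _
  | succ j => simp [Setup.first, Finset.sum_range_succ]

theorem Setup.le_first (hs : ∀ i, 1 ≤ S.s i) (j : ℕ) : S.k + j ≤ S.first (j + 1) := by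
  rw [Setup.first]
  refine Nat.add_le_add_left ?_ _
  calc j = ∑ _i ∈ Finset.range j, 1 := by simp
    _ ≤ _ := Finset.sum_le_sum fun i _ => hs i

/-- Logarithmic factor of the cost of sorting labels. -/
def sortFactor (V : Type u) [Fintype V] : ℕ := Nat.log 2 (Fintype.card V * Fintype.card V) + 1

theorem sortCost_le {K : ℕ} (hK : K ≤ Fintype.card V * Fintype.card V) :
    sortCost K ≤ K * sortFactor V :=
  Nat.mul_le_mul_left _ (Nat.succ_le_succ (Nat.log_mono_right hK))

/-- Bound on the work outside of the trees, in terms of the labels broadcast. -/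
def Setup.phaseBudget (S : Setup V) (B superstep broadcast : ℕ) : ℕ :=
  (if superstep = 0 then 0 else Fintype.card V * S.k * sortFactor V) + superstep +
    broadcast * (sortFactor V + 1 + 2 * (S.k + B))

/-- Invariant of the executions of the algorithm. -/
structure GlobalInv (S : Setup V) (B : ℕ) (C : Config V) (g : V → History V) : Prop where
  tree : ∀ h, TreeInv S (S.k + B) h (C.status h) (g h)
  done : ∀ h, S.treeId h < S.first C.superstep → C.status h = .done
  waiting : C.superstep = 0 → ∀ h, S.k ≤ S.treeId h → C.status h = .waiting
  table : TableInv S (C.glob ∪ C.loc) g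
  loc : ∀ l ∈ C.loc, S.first C.superstep ≤ S.treeId l.hub
  generated_le : C.generated ≤ ∑ h, (g h).relaxed.card
  glob_le : C.glob.card + C.loc.card ≤ C.generated
  broadcast_zero : C.superstep = 0 → C.broadcast = 0
  broadcast_le : C.superstep ≠ 0 → C.broadcast + C.loc.card ≤
    ∑ h ∈ Finset.univ.filter (fun h => S.k ≤ S.treeId h), (g h).relaxed.card
  work_le : C.work ≤ ∑ h, (g h).cost + S.phaseBudget B C.superstep C.broadcast
  superstep_le : C.superstep ≤ Fintype.card V + 1

theorem GlobalInv.init (S : Setup V) (B : ℕ) :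
    GlobalInv S B Config.init fun _ => ⟨∅, ∅, 0⟩ where
  tree _ := ⟨rfl, rfl, rfl⟩
  done h hh := absurd hh (Nat.not_lt_zero _)
  waiting _ _ _ := rfl
  table := ⟨by simp [Config.init], by simp [Config.init], by simp [Config.init],
    by simp [Config.init], by simp⟩
  loc := by simp [Config.init]
  generated_le := by simp [Config.init]
  glob_le := by simp [Config.init]
  broadcast_zero _ := rfl
  broadcast_le := by simp [Config.init]
  work_le := by simp [Config.init]
  superstep_le := Nat.zero_le _

theorem GlobalInv.low {B : ℕ} {C : Config V} {g : V → History V} (I : GlobalInv S B C g) :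
    ∀ h x, S.k ≤ S.treeId h → x ∈ (g h).relaxed → S.LowReach h x :=
  fun h _ hk hx => (I.tree h).low hk hx

theorem GlobalInv.card_labelsAt_le {B : ℕ} (hB : S.HubBound B) {C : Config V} {g : V → History V}
    (I : GlobalInv S B C g) (x : V) : (labelsAt (C.glob ∪ C.loc) x).card ≤ S.k + B :=
  I.table.card_labelsAt_le hB I.low x

/-- A step in the tree of `h`, which generates the labels `N`. -/
theorem GlobalInv.treeStep {B : ℕ} {C C' : Config V} {g : V → History V} (I : GlobalInv S B C g)
    {h : V} {st : Status V} {γ : History V} {N : Finset (Label V)} {c : ℕ}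
    (hsuper : C'.superstep = C.superstep) (hstatus : C'.status = Function.update C.status h st)
    (hglob : C'.glob = C.glob) (hloc : C'.loc = C.loc ∪ N)
    (hgen : C'.generated = C.generated + N.card) (hwork : C'.work = C.work + c)
    (hbroad : C'.broadcast = C.broadcast)
    (tree : TreeInv S (S.k + B) h st γ) (hfirst : S.first C.superstep ≤ S.treeId h)
    (hzero : C.superstep = 0 → S.treeId h < S.k)
    (table : TableInv S (C.glob ∪ C.loc ∪ N) (Function.update g h γ))
    (hub : ∀ l ∈ N, l.hub = h) (card : (g h).relaxed.card + N.card ≤ γ.relaxed.card)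
    (cost : γ.cost = (g h).cost + c) : GlobalInv S B C' (Function.update g h γ) where
  tree h' := by
    rw [hstatus]
    by_cases hh : h' = h
    · subst hh; simpa using tree
    · simpa [Function.update_of_ne hh] using I.tree h'
  done h' hh' := by
    rw [hsuper] at hh'
    have hh : h' ≠ h := by rintro rfl; exact absurd hh' (not_lt.2 hfirst)
    rw [hstatus, Function.update_of_ne hh]
    exact I.done h' hh'
  waiting h0 h' hk := by
    rw [hsuper] at h0
    have hh : h' ≠ h := by rintro rfl; exact absurd (hzero h0) (not_lt.2 hk)
    rw [hstatus, Function.update_of_ne hh]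
    exact I.waiting h0 h' hk
  table := by rwa [hglob, hloc, ← Finset.union_assoc]
  loc l hl := by
    rw [hsuper]
    rw [hloc] at hl
    rcases Finset.mem_union.1 hl with hl | hl
    · exact I.loc l hl
    · rwa [hub l hl]
  generated_le := by
    rw [hgen, sum_update_eq (Finset.mem_univ h) (fun γ => γ.relaxed.card) g γ
      (Nat.add_sub_cancel' ((Nat.le_add_right _ _).trans card)).symm]
    have := I.generated_le
    omega
  glob_le := by
    rw [hglob, hloc, hgen]
    have := Finset.card_union_le C.loc N
    have := I.glob_le
    omega
  broadcast_zero h0 := by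
    rw [hbroad]
    exact I.broadcast_zero (hsuper ▸ h0)
  broadcast_le h0 := by
    rw [hsuper] at h0
    have hk : S.k ≤ S.treeId h := by
      refine le_trans ?_ hfirst
      calc S.k = S.first 1 := by simp [Setup.first]
        _ ≤ _ := Setup.first_mono (Nat.one_le_iff_ne_zero.2 h0)
    rw [hbroad, hloc, sum_update_eq (by simpa using hk) (fun γ => γ.relaxed.card) g γ
      (Nat.add_sub_cancel' ((Nat.le_add_right _ _).trans card)).symm]
    have := I.broadcast_le h0
    have := Finset.card_union_le C.loc N
    omega
  work_le := by
    rw [hwork, hsuper, hbroad, sum_update_eq (Finset.mem_univ h) (fun γ => γ.cost) g γ cost]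
    have := I.work_le
    omega
  superstep_le := hsuper ▸ I.superstep_le

theorem GlobalInv.first_le {B : ℕ} {C : Config V} {g : V → History V} (I : GlobalInv S B C g)
    {h : V} (hh : C.status h ≠ .done) : S.first C.superstep ≤ S.treeId h :=
  not_lt.1 fun hlt => hh (I.done h hlt)

theorem GlobalInv.lt_of_zero {B : ℕ} {C : Config V} {g : V → History V} (I : GlobalInv S B C g)
    {h : V} (hh : C.status h ≠ .waiting) (h0 : C.superstep = 0) : S.treeId h < S.k :=
  not_le.1 fun hle => hh (I.waiting h0 h hle)

theorem GlobalInv.step {B : ℕ} (hpos : ∀ e ∈ S.G.edgeSet, 0 < S.wt e) (hs : ∀ i, 1 ≤ S.s i)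
    (hB : S.HubBound B) {C C' : Config V} {g : V → History V} (I : GlobalInv S B C g)
    (step : S.Step C C') : ∃ g', GlobalInv S B C' g' := by
  cases step with
  | startPlant h phase start =>
    obtain ⟨hbatch, hw, -⟩ := start
    have T := I.tree h
    rw [hw] at T
    have hk : S.treeId h < S.k := by
      have := hbatch.2
      rw [phase] at this
      simpa [Setup.first] using this
    refine ⟨_, I.treeStep (N := ∅) (c := 1) rfl rfl rfl (by simp) (by simp) rfl rfl
      (st := .plant (PlantTree.init h)) (PlantInv.init hk) hbatch.1 (fun _ => hk) ?_ (by simp)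
      (by simp [T.2.1]) (by simp [T.2.2])⟩
    rw [Finset.union_empty]
    exact I.table.update_cost T.1.symm T.2.1.symm
  | iterPlant h x t ht live head =>
    have T := I.tree h
    rw [ht] at T
    have T : PlantInv S h t (g h) := T
    have hxP := T.dijkstra.not_popped x head.1
    have hxA : x ∉ (g h).relaxed := fun hxA => hxP (T.dijkstra.subset hxA)
    have hN : ∀ l ∈ S.plantLabel t h x, l = ⟨x, h, t.dist x⟩ ∧ x ∈ insert x (g h).relaxed ∧
        S.R x ≤ S.R h := by
      intro l hl
      unfold Setup.plantLabel at hl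
      split_ifs at hl with hR
      · simp at hl
      · exact ⟨Finset.mem_singleton.1 hl, Finset.mem_insert_self _ _,
          (Setup.le_higher_left _ _).trans (not_lt.1 hR)⟩
    refine ⟨_, I.treeStep (N := S.plantLabel t h x) rfl rfl rfl rfl rfl rfl rfl
      (st := .plant (S.plantIter t x)) (T.iter hpos head) (I.first_le (by simp [ht]))
      (fun _ => T.phase) ?_ (fun l hl => by rw [(hN l hl).1]) ?_ rfl⟩
    · exact I.table.insert _ hxA (Finset.subset_insert _ _) hN (T.dijkstra.dist_le x)
        (T.mem_plantLabel hpos head)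
    · rw [Finset.card_insert_of_notMem hxA]
      exact Nat.add_le_add_left (S.card_plantLabel_le t h x) _
  | endPlant h t ht dead =>
    have T := I.tree h
    rw [ht] at T
    have T : PlantInv S h t (g h) := T
    refine ⟨_, I.treeStep (N := ∅) rfl rfl rfl (by simp) (by simp) rfl rfl
      (st := .done) (T.finish hpos (S.k + B) dead) (I.first_le (by simp [ht]))
      (fun _ => T.phase) ?_ (by simp) (by simp) rfl⟩
    rw [Finset.union_empty]
    exact I.table.update_cost rfl rfl
  | switch phase complete =>
    have hloc : ∀ l ∈ C.loc, l.hub ∈ Finset.univ.filter fun h => S.treeId h < S.k := by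
      intro l hl
      refine Finset.mem_filter.2 ⟨Finset.mem_univ _, I.lt_of_zero (fun hw => ?_) phase⟩
      have T := I.tree l.hub
      have hm := I.table.mem_relaxed l (Finset.mem_union_right _ hl)
      rw [hw] at T
      simp [T.2.1] at hm
    have hcard : C.loc.card ≤ Fintype.card V * S.k :=
      (card_labels_le _ hloc fun l hl l' hl' => I.table.unique l (Finset.mem_union_right _ hl)
        l' (Finset.mem_union_right _ hl')).trans
        (Nat.mul_le_mul_left _ (Setup.card_treeId_lt_le _))
    have hcard' : C.loc.card ≤ Fintype.card V * Fintype.card V :=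
      card_labels_le Finset.univ (by simp) fun l hl l' hl' =>
        I.table.unique l (Finset.mem_union_right _ hl) l' (Finset.mem_union_right _ hl')
    have hsort := (sortCost_le hcard').trans (Nat.mul_le_mul_right (sortFactor V) hcard)
    refine ⟨g, I.tree, ?_, by simp, by simpa using I.table, by simp, I.generated_le, ?_, by simp,
      ?_, ?_, by simp⟩
    · intro h hh
      exact complete h ⟨Nat.zero_le _, hh⟩
    · have := I.glob_le
      have := Finset.card_union_le C.glob C.loc
      simp only [Finset.card_empty]
      omega
    · intro _
      simp [I.broadcast_zero phase]
    · have := I.work_le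
      rw [Setup.phaseBudget, if_pos phase, phase] at this
      rw [Setup.phaseBudget, if_neg one_ne_zero]
      dsimp only
      omega
  | startGll h phase start =>
    obtain ⟨hbatch, hw, -⟩ := start
    have T := I.tree h
    rw [hw] at T
    have hk : S.k ≤ S.treeId h := by
      refine le_trans ?_ hbatch.1
      calc S.k = S.first 1 := by simp [Setup.first]
        _ ≤ _ := Setup.first_mono (Nat.one_le_iff_ne_zero.2 phase)
    have hLR : ∀ b ∈ S.nodeLabels C h h,
        b.hub ≠ h ∧ S.R h ≤ S.R b.hub ∧ S.dist h b.hub ≤ b.d := by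
      intro b hb
      rw [Setup.nodeLabels, labelsAt, Finset.mem_filter, Finset.mem_filter] at hb
      obtain ⟨⟨hb, hv⟩, -⟩ := hb
      refine ⟨fun hbh => ?_, hv ▸ I.table.rank_le b hb, hv ▸ I.table.dist_le b hb⟩
      -- the tree of `h` has just been started, so there are no labels with hub `h`
      have hm := I.table.mem_relaxed b hb
      rw [hbh, T.2.1] at hm
      simp at hm
    refine ⟨_, I.treeStep (N := ∅) (c := 1 + (S.nodeLabels C h h).card) rfl rfl rfl
      (by simp) (by simp) rfl rfl (st := .gll (GllTree.init h (S.nodeLabels C h h)))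
      (GllInv.init hk hLR ((card_nodeLabels_le C h h).trans (I.card_labelsAt_le hB h)))
      hbatch.1 (fun h0 => absurd h0 phase) ?_ (by simp) (by simp [T.2.1]) (by simp [T.2.2])⟩
    rw [Finset.union_empty]
    exact I.table.update_cost T.1.symm T.2.1.symm
  | iterGll h x t ht head =>
    have T := I.tree h
    rw [ht] at T
    have T : GllInv S (S.k + B) h t (g h) := T
    have hxP := T.dijkstra.not_popped x head.1
    have hxA : x ∉ (g h).relaxed := fun hxA => hxP (T.dijkstra.subset hxA)
    refine ⟨_, I.treeStep (N := S.gllLabel C t h x) (c := S.gllCost C t h x)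
      rfl rfl rfl rfl rfl rfl rfl
      (st := .gll (S.gllIter C t h x)) (T.iter hpos head I.table.dist_le
        ((card_nodeLabels_le C h x).trans (I.card_labelsAt_le hB x)))
      (I.first_le (by simp [ht])) (I.lt_of_zero (by simp [ht])) ?_ ?_ ?_ rfl⟩
    · refine I.table.insert (δ := t.dist x) _ hxA ?_ ?_ (T.dijkstra.dist_le x) fun hc =>
        ⟨T.dijkstra.head_eq hpos T.exact_on_canon head hc, ?_⟩
      · split_ifs
        · exact Finset.subset_insert _ _
        · exact Finset.Subset.refl _
      · intro l hl
        unfold Setup.gllLabel at hl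
        split_ifs at hl with hacc
        · exact ⟨Finset.mem_singleton.1 hl, by simp [hacc], hacc.1⟩
        · simp at hl
      · simp [Setup.gllLabel, T.accepts_of_canon hpos head I.table.dist_le hc]
    · intro l hl
      unfold Setup.gllLabel at hl
      split_ifs at hl with hacc
      · rw [Finset.mem_singleton.1 hl]
      · simp at hl
    · unfold Setup.gllLabel
      split_ifs with hacc
      · simp [Finset.card_insert_of_notMem hxA]
      · simp
  | endGll h t ht empty =>
    have T := I.tree h
    rw [ht] at T
    have T : GllInv S (S.k + B) h t (g h) := T
    refine ⟨_, I.treeStep (N := ∅) rfl rfl rfl (by simp) (by simp) rfl rfl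
      (st := .done) (T.finish hpos empty) (I.first_le (by simp [ht]))
      (I.lt_of_zero (by simp [ht])) ?_ (by simp) (by simp) rfl⟩
    rw [Finset.union_empty]
    exact I.table.update_cost rfl rfl
  | sync phase more complete =>
    have hcard' : C.loc.card ≤ Fintype.card V * Fintype.card V :=
      card_labels_le Finset.univ (by simp) fun l hl l' hl' =>
        I.table.unique l (Finset.mem_union_right _ hl) l' (Finset.mem_union_right _ hl')
    have hsort := sortCost_le hcard'
    have hclean : Setup.cleanCost (C.glob ∪ C.loc) C.loc ≤ C.loc.card * (1 + 2 * (S.k + B)) := by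
      rw [← smul_eq_mul]
      refine Finset.sum_le_card_nsmul _ _ _ fun l _ => ?_
      have h1 := I.card_labelsAt_le hB l.vertex
      have h2 := I.card_labelsAt_le hB l.hub
      omega
    refine ⟨g, I.tree, ?_, by simp, by simpa using I.table.clean, by simp, I.generated_le, ?_,
      by simp, ?_, ?_, ?_⟩
    · intro h hh
      rcases lt_or_ge (S.treeId h) (S.first C.superstep) with hlt | hge
      · exact I.done h hlt
      · exact complete h ⟨hge, hh⟩
    · have h1 := I.glob_le
      have h2 := Finset.card_union_le C.glob
        (C.loc.filter fun l => ¬ S.Redundant (C.glob ∪ C.loc) l)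
      have h3 := Finset.card_filter_le C.loc fun l => ¬ S.Redundant (C.glob ∪ C.loc) l
      simp only [Finset.card_empty]
      omega
    · intro _
      simpa using I.broadcast_le phase
    · have := I.work_le
      rw [Setup.phaseBudget, if_neg phase] at this
      rw [Setup.phaseBudget, if_neg (Nat.succ_ne_zero _)]
      have h1 : (C.broadcast + C.loc.card) * (sortFactor V + 1 + 2 * (S.k + B)) =
          C.broadcast * (sortFactor V + 1 + 2 * (S.k + B)) + C.loc.card * sortFactor V +
            C.loc.card * (1 + 2 * (S.k + B)) := by ring
      dsimp only
      omega
    · obtain ⟨j, hj⟩ := Nat.exists_eq_succ_of_ne_zero phase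
      have := Setup.le_first hs j
      rw [hj] at more ⊢
      dsimp only
      change S.first (j + 1) < _ at more
      omega

theorem GlobalInv.of_reaches {B : ℕ} (hpos : ∀ e ∈ S.G.edgeSet, 0 < S.wt e) (hs : ∀ i, 1 ≤ S.s i)
    (hB : S.HubBound B) {C : Config V} (hC : S.Reaches Config.init C) :
    ∃ g, GlobalInv S B C g := by
  induction hC with
  | refl => exact ⟨_, GlobalInv.init S B⟩
  | tail _ step ih =>
    obtain ⟨g, I⟩ := ih
    exact I.step hpos hs hB step

end Global

/-! ### Hubs in centroid decompositions -/

section Centroid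

variable {τ : Type v}

theorem component_subset (T : SimpleGraph τ) (A : Set τ) (x : τ) : component T A x ⊆ A :=
  fun _ hy => hy.2.1

theorem mem_component_self (T : SimpleGraph τ) {A : Set τ} {x : τ} (hx : x ∈ A) :
    x ∈ component T A x :=
  ⟨hx, hx, .rfl⟩

theorem component_eq {T : SimpleGraph τ} {A : Set τ} {x y : τ} (hy : y ∈ component T A x) :
    component T A y = component T A x := by
  obtain ⟨hx, hyA, hxy⟩ := hy
  ext z
  exact ⟨fun ⟨_, hz, hyz⟩ => ⟨hx, hz, hxy.trans hyz⟩,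
    fun ⟨_, hz, hxz⟩ => ⟨hyA, hz, hxy.symm.trans hxz⟩⟩

theorem CentroidDepth.le_dep {T : SimpleGraph τ} {dep : τ → ℕ} {k : ℕ} {A : Set τ}
    (hC : CentroidDepth T dep k A) : ∀ a ∈ A, k ≤ dep a := by
  induction hC with
  | node k A z hz hdep centroid rec ih =>
    intro a ha
    by_cases haz : a = z
    · rw [haz, hdep]
    · exact (Nat.le_succ k).trans (ih a ⟨ha, haz⟩ a (mem_component_self T ⟨ha, haz⟩))

variable {V : Type u} {G : SimpleGraph V} {w c : ℕ}

/-- All bags of `x` belong to `A`. -/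
def RelaxedTreeDecomposition.LivesIn (D : RelaxedTreeDecomposition G w c τ) (A : Set τ) (x : V) :
    Prop :=
  ∀ t, x ∈ D.bag t → t ∈ A

theorem RelaxedTreeDecomposition.exists_bag (D : RelaxedTreeDecomposition G w c τ) (x : V) :
    ∃ t, x ∈ D.bag t :=
  let ⟨t⟩ := (D.connected x).nonempty
  ⟨t.1, t.2⟩

theorem RelaxedTreeDecomposition.LivesIn.component {D : RelaxedTreeDecomposition G w c τ}
    {A : Set τ} {x : V} (hx : D.LivesIn A x) {t : τ} (ht : x ∈ D.bag t) :
    D.LivesIn (component D.tree A t) x := by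
  intro t' ht'
  refine ⟨hx t ht, hx t' ht', ?_⟩
  exact ((D.connected x).preconnected ⟨t, ht⟩ ⟨t', ht'⟩).map
    (SimpleGraph.induceHomOfLE D.tree hx).toHom

theorem RelaxedTreeDecomposition.vertexDepth_le (D : RelaxedTreeDecomposition G w c τ)
    (dep : τ → ℕ) {x : V} {t : τ} (ht : x ∈ D.bag t) : D.vertexDepth dep x ≤ dep t :=
  Nat.sInf_le ⟨t, ht, rfl⟩

theorem RelaxedTreeDecomposition.exists_dep_eq (D : RelaxedTreeDecomposition G w c τ)
    (dep : τ → ℕ) (x : V) : ∃ t, x ∈ D.bag t ∧ dep t = D.vertexDepth dep x := by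
  obtain ⟨t, ht⟩ := D.exists_bag x
  exact Nat.sInf_mem (s := dep '' {t | x ∈ D.bag t}) ⟨_, t, ht, rfl⟩

/-- `v` can be reached from `h` by a walk of vertices that live in `A` and are not ranked higher
than `h` by `R`. -/
def RelaxedTreeDecomposition.ReachIn {ρ : Type*} [LE ρ] (D : RelaxedTreeDecomposition G w c τ)
    (R : V → ρ) (A : Set τ) (h v : V) : Prop :=
  Relation.ReflTransGen (fun a b => G.Adj a b ∧ R b ≤ R h ∧ D.LivesIn A b) h v

/-- If the vertices that live in `A` but not in `U` are ranked higher than `h`, then the walks from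
`h` in `A` stay in the component of `h` in `U`. -/
theorem RelaxedTreeDecomposition.ReachIn.descend {ρ : Type*} [LE ρ]
    {D : RelaxedTreeDecomposition G w c τ} {R : V → ρ} {A U : Set τ} {h v : V}
    (hU : ∀ b, D.LivesIn A b → R b ≤ R h → D.LivesIn U b) (hh : D.LivesIn U h)
    (hv : D.ReachIn R A h v) {t : τ} (ht : v ∈ D.bag t) :
    D.LivesIn (HubLabeling.component D.tree U t) v ∧
      D.LivesIn (HubLabeling.component D.tree U t) h ∧
      D.ReachIn R (HubLabeling.component D.tree U t) h v := by
  obtain ⟨s, hs⟩ := D.exists_bag h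
  suffices H : D.LivesIn (HubLabeling.component D.tree U s) v ∧
      D.ReachIn R (HubLabeling.component D.tree U s) h v by
    rw [component_eq (H.1 t ht)]
    exact ⟨H.1, hh.component hs, H.2⟩
  clear ht
  induction hv with
  | refl => exact ⟨hh.component hs, .refl⟩
  | tail _ hab ih =>
    obtain ⟨hadj, hR, hA⟩ := hab
    obtain ⟨r, hr, hr'⟩ := D.edge_covered _ _ hadj
    have hlive := (hU _ hA hR).component hr'
    rw [component_eq (ih.1 r hr)] at hlive
    exact ⟨hlive, ih.2.tail ⟨hadj, hR, hlive⟩⟩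

/-- In a centroid decomposition of a subtree `A` without the root, a vertex is reached by at most
`c` hubs per level. A hub either is in the bag of the centroid or its walks stay in one component,
whose size is at most half that of `A`. -/
theorem CentroidDepth.card_hubs_le [Fintype τ] [Fintype V] {ρ : Type*} [LinearOrder ρ]
    {D : RelaxedTreeDecomposition G w c τ} {R : V → ρ} {dep : τ → ℕ}
    (hR : ∀ x y, D.vertexDepth dep x < D.vertexDepth dep y → R y < R x) {k : ℕ} {A : Set τ}
    (hC : CentroidDepth D.tree dep k A) : D.root ∉ A → ∀ v,
    (Finset.univ.filter fun h => D.LivesIn A h ∧ D.ReachIn R A h v).card ≤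
      c * (Nat.log 2 A.ncard + 1) := by
  induction hC with
  | node k A z hz hdep centroid rec ih =>
    intro hroot v
    have hcard : (D.bag z).card ≤ c := D.card_le z fun hzr => hroot (hzr ▸ hz)
    -- hubs outside the bag of `z` cannot use vertices of this bag, since these are ranked higher
    have key : ∀ h, D.LivesIn A h → h ∉ D.bag z → D.ReachIn R A h v → ∀ t, v ∈ D.bag t →
        D.LivesIn (component D.tree (A \ {z}) t) v ∧
        D.LivesIn (component D.tree (A \ {z}) t) h ∧
        D.ReachIn R (component D.tree (A \ {z}) t) h v := by
      intro h hh hhz hv t ht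
      have hh' : D.LivesIn (A \ {z}) h := fun s hs => ⟨hh s hs, by rintro rfl; exact hhz hs⟩
      refine RelaxedTreeDecomposition.ReachIn.descend (U := A \ {z})
        (fun b hb hbh s hs => ⟨hb s hs, ?_⟩) hh' hv ht
      rintro rfl
      obtain ⟨r, hr, hdr⟩ := D.exists_dep_eq dep h
      have h1 := D.vertexDepth_le dep hs
      have h2 := (rec r (hh' r hr)).le_dep r (mem_component_self D.tree (hh' r hr))
      exact absurd (hR b h (by omega)) (not_lt.2 hbh)
    obtain ⟨t, ht⟩ := D.exists_bag v
    by_cases hne : ∃ h, D.LivesIn A h ∧ h ∉ D.bag z ∧ D.ReachIn R A h v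
    · obtain ⟨h₀, hh₀, hhz₀, hv₀⟩ := hne
      have htA : t ∈ A \ {z} := component_subset _ _ _ ((key h₀ hh₀ hhz₀ hv₀ t ht).1 t ht)
      have hsub : (Finset.univ.filter fun h => D.LivesIn A h ∧ D.ReachIn R A h v) ⊆
          D.bag z ∪ Finset.univ.filter fun h =>
            D.LivesIn (component D.tree (A \ {z}) t) h ∧
              D.ReachIn R (component D.tree (A \ {z}) t) h v := by
        intro h hh
        rw [Finset.mem_filter] at hh
        rw [Finset.mem_union, Finset.mem_filter]
        by_cases hhz : h ∈ D.bag z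
        · exact Or.inl hhz
        · exact Or.inr ⟨Finset.mem_univ h, (key h hh.2.1 hhz hh.2.2 t ht).2⟩
      have hih := ih t htA (fun hr => hroot (component_subset _ _ _ hr).1) v
      have hlog : Nat.log 2 (component D.tree (A \ {z}) t).ncard + 1 ≤ Nat.log 2 A.ncard := by
        have hpos : (component D.tree (A \ {z}) t).ncard ≠ 0 :=
          ((Set.ncard_pos (Set.toFinite _)).2 ⟨t, mem_component_self D.tree htA⟩).ne'
        rw [← Nat.log_mul_base one_lt_two hpos, mul_comm]
        exact Nat.log_mono_right (centroid t htA)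
      calc _ ≤ c + c * (Nat.log 2 (component D.tree (A \ {z}) t).ncard + 1) :=
            (Finset.card_le_card hsub).trans
              ((Finset.card_union_le _ _).trans (add_le_add hcard hih))
        _ ≤ c + c * Nat.log 2 A.ncard := Nat.add_le_add_left (Nat.mul_le_mul_left _ hlog) _
        _ = _ := by ring
    · push Not at hne
      calc _ ≤ (D.bag z).card := Finset.card_le_card fun h hh => by
            rw [Finset.mem_filter] at hh
            by_contra hhz
            exact hne h hh.2.1 hhz hh.2.2
        _ ≤ c * 1 := by rwa [mul_one]
        _ ≤ _ := Nat.mul_le_mul_left _ (Nat.succ_le_succ (Nat.zero_le _))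

variable [Fintype V]

/-- The vertices of the root bag are the highest ranked ones. -/
theorem RelaxedTreeDecomposition.IsCentroidDepth.lt_of_mem_root
    {D : RelaxedTreeDecomposition G w c τ} {dep : τ → ℕ} (hdep : D.IsCentroidDepth dep)
    {R : V ≃ Fin (Fintype.card V)}
    (hR : ∀ x y, D.vertexDepth dep x < D.vertexDepth dep y → R y < R x) {h : V}
    (hh : h ∈ D.bag D.root) : ((R h).rev : ℕ) < w := by
  have h0 : D.vertexDepth dep h = 0 := by
    have := D.vertexDepth_le dep hh
    rw [hdep.1] at this
    omega
  have hsub : (Finset.Ici (R h)).map R.symm.toEmbedding ⊆ D.bag D.root := by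
    intro x hx
    obtain ⟨i, hi, rfl⟩ := Finset.mem_map.1 hx
    obtain ⟨t, ht, hdt⟩ := D.exists_dep_eq dep (R.symm i)
    have hz : dep t = 0 := by
      by_contra hne
      have hlt := hR h (R.symm i) (by omega)
      rw [Equiv.apply_symm_apply] at hlt
      exact absurd (Finset.mem_Ici.1 hi) (not_le.2 hlt)
    by_cases htr : t = D.root
    · exact htr ▸ ht
    · have := (hdep.2 t htr).le_dep t (mem_component_self D.tree htr)
      omega
  have := Finset.card_le_card hsub
  rw [Finset.card_map, Fin.card_Ici, D.card_root] at this
  have := (R h).isLt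
  rw [Fin.val_rev]
  omega

/-- A ranking induced by a relaxed tree decomposition leaves every vertex with `O(c log |τ|)` hubs
outside the root bag. -/
theorem Setup.hubBound_of_induces [Fintype τ] {S : Setup V} {w c : ℕ}
    {D : RelaxedTreeDecomposition S.G w c τ} (hD : D.Induces S.R) (hk : S.k = w) :
    S.HubBound (c * (Nat.log 2 (Fintype.card τ) + 1)) := by
  obtain ⟨dep, hdep, hR⟩ := hD
  intro v
  -- no vertex of the root bag is ranked below a hub outside of it
  have key : ∀ h, S.k ≤ S.treeId h → S.LowReach h v → ∀ t, v ∈ D.bag t →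
      D.LivesIn (component D.tree {D.root}ᶜ t) v ∧
      D.LivesIn (component D.tree {D.root}ᶜ t) h ∧
      D.ReachIn S.R (component D.tree {D.root}ᶜ t) h v := by
    intro h hh hv t ht
    have hhr : D.LivesIn {D.root}ᶜ h := by
      rintro s hs rfl
      have : S.treeId h < w := hdep.lt_of_mem_root hR hs
      omega
    have hv' : D.ReachIn S.R Set.univ h v := by
      refine Relation.ReflTransGen.mono (fun a b hab => ?_) _ _ hv
      exact ⟨hab.1, hab.2, fun _ _ => Set.mem_univ _⟩
    refine hv'.descend (fun b _ hbh => ?_) hhr ht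
    rintro s hs rfl
    obtain ⟨r, hr, hdr⟩ := D.exists_dep_eq dep h
    have h1 := D.vertexDepth_le dep hs
    have h2 := (hdep.2 r (hhr r hr)).le_dep r (mem_component_self D.tree (hhr r hr))
    rw [hdep.1] at h1
    exact absurd (hR b h (by omega)) (not_lt.2 hbh)
  obtain ⟨t, ht⟩ := D.exists_bag v
  by_cases hne : ∃ h, S.k ≤ S.treeId h ∧ S.LowReach h v
  · obtain ⟨h₀, hh₀, hv₀⟩ := hne
    have htr : t ∈ ({D.root}ᶜ : Set τ) := component_subset _ _ _ ((key h₀ hh₀ hv₀ t ht).1 t ht)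
    have hsub : (Finset.univ.filter fun h => S.k ≤ S.treeId h ∧ S.LowReach h v) ⊆
        Finset.univ.filter fun h => D.LivesIn (component D.tree {D.root}ᶜ t) h ∧
          D.ReachIn S.R (component D.tree {D.root}ᶜ t) h v := by
      intro h hh
      rw [Finset.mem_filter] at hh ⊢
      exact ⟨hh.1, (key h hh.2.1 hh.2.2 t ht).2⟩
    refine (Finset.card_le_card hsub).trans (((hdep.2 t htr).card_hubs_le hR
      (fun hr => component_subset _ _ _ hr rfl) v).trans ?_)
    refine Nat.mul_le_mul_left _ (Nat.succ_le_succ (Nat.log_mono_right ?_))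
    rw [← Nat.card_eq_fintype_card]
    exact Set.ncard_le_card _
  · push Not at hne
    rw [Finset.card_eq_zero.2 (Finset.filter_eq_empty_iff.2 fun h _ hh => hne h hh.1 hh.2)]
    exact Nat.zero_le _

end Centroid

/-! ### Queries -/

section Query

variable {V : Type u} [Fintype V] {S : Setup V}

theorem Setup.le_mergeQuery {d : ℝ≥0∞} (as bs : List (Label V)) :
    (∀ a ∈ as, ∀ b ∈ bs, a.hub = b.hub → d ≤ a.d + b.d) → d ≤ (S.mergeQuery as bs).1 := by
  induction as, bs using Setup.mergeQuery.induct S with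
  | case1 => intro; simp [Setup.mergeQuery]
  | case2 => intro; simp [Setup.mergeQuery]
  | case3 a as b bs hab ih =>
    intro H
    rw [Setup.mergeQuery, if_pos hab]
    exact le_min (H a (by simp) b (by simp) hab)
      (ih fun a' ha' b' hb' => H a' (by simp [ha']) b' (by simp [hb']))
  | case4 a as b bs hab hR ih =>
    intro H
    rw [Setup.mergeQuery, if_neg hab, if_pos hR]
    exact ih fun a' ha' b' hb' => H a' (by simp [ha']) b' hb'
  | case5 a as b bs hab hR ih =>
    intro H
    rw [Setup.mergeQuery, if_neg hab, if_neg hR]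
    exact ih fun a' ha' b' hb' => H a' ha' b' (by simp [hb'])

theorem Setup.mergeQuery_le (as bs : List (Label V)) :
    as.Pairwise (fun a b => S.R b.hub < S.R a.hub) →
    bs.Pairwise (fun a b => S.R b.hub < S.R a.hub) →
    ∀ a ∈ as, ∀ b ∈ bs, a.hub = b.hub → (S.mergeQuery as bs).1 ≤ a.d + b.d := by
  induction as, bs using Setup.mergeQuery.induct S with
  | case1 => intro _ _ a ha; simp at ha
  | case2 => intro _ _ a _ b hb; simp at hb
  | case3 a as b bs hab ih =>
    intro ha hb a' ha' b' hb' hab'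
    rw [Setup.mergeQuery, if_pos hab]
    rw [List.pairwise_cons] at ha hb
    rcases List.mem_cons.1 ha' with rfl | ha' <;> rcases List.mem_cons.1 hb' with rfl | hb'
    · exact min_le_left _ _
    · exact absurd (hb.1 b' hb') (by rw [← hab', hab]; exact lt_irrefl _)
    · exact absurd (ha.1 a' ha') (by rw [hab', hab]; exact lt_irrefl _)
    · exact (min_le_right _ _).trans (ih ha.2 hb.2 a' ha' b' hb' hab')
  | case4 a as b bs hab hR ih =>
    intro ha hb a' ha' b' hb' hab'
    rw [Setup.mergeQuery, if_neg hab, if_pos hR]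
    rcases List.mem_cons.1 ha' with rfl | ha'
    · rcases List.mem_cons.1 hb' with rfl | hb''
      · exact absurd hab' hab
      · have := (List.pairwise_cons.1 hb).1 b' hb''
        rw [← hab'] at this
        exact absurd this hR.not_gt
    · exact ih (List.pairwise_cons.1 ha).2 hb a' ha' b' hb' hab'
  | case5 a as b bs hab hR ih =>
    intro ha hb a' ha' b' hb' hab'
    rw [Setup.mergeQuery, if_neg hab, if_neg hR]
    rcases List.mem_cons.1 hb' with rfl | hb'
    · rcases List.mem_cons.1 ha' with rfl | ha''
      · exact absurd hab' hab
      · have := (List.pairwise_cons.1 ha).1 a' ha''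
        rw [hab'] at this
        exact absurd this hR
    · exact ih ha (List.pairwise_cons.1 hb).2 a' ha' b' hb' hab'

theorem Setup.mergeQuery_steps_le (as bs : List (Label V)) :
    (S.mergeQuery as bs).2 ≤ as.length + bs.length + 1 := by
  induction as, bs using Setup.mergeQuery.induct S with
  | case1 => simp [Setup.mergeQuery]
  | case2 => simp [Setup.mergeQuery]
  | case3 a as b bs hab ih =>
    rw [Setup.mergeQuery, if_pos hab]
    simp only [List.length_cons]
    omega
  | case4 a as b bs hab hR ih =>
    rw [Setup.mergeQuery, if_neg hab, if_pos hR]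
    simp only [List.length_cons] at ih ⊢
    omega
  | case5 a as b bs hab hR ih =>
    rw [Setup.mergeQuery, if_neg hab, if_neg hR]
    simp only [List.length_cons] at ih ⊢
    omega

theorem Setup.mem_sortedLabels {L : Finset (Label V)} {x : V} {l : Label V} :
    l ∈ S.sortedLabels L x ↔ l ∈ L ∧ l.vertex = x := by
  rw [Setup.sortedLabels, List.mem_mergeSort, Finset.mem_toList, labelsAt, Finset.mem_filter]

theorem Setup.length_sortedLabels (L : Finset (Label V)) (x : V) :
    (S.sortedLabels L x).length = (labelsAt L x).card := by
  rw [Setup.sortedLabels, List.length_mergeSort, Finset.length_toList]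

theorem TableInv.pairwise_sortedLabels {L : Finset (Label V)} {g : V → History V}
    (I : TableInv S L g) (x : V) :
    (S.sortedLabels L x).Pairwise fun a b => S.R b.hub < S.R a.hub := by
  have hsort : (S.sortedLabels L x).Pairwise fun a b => S.R b.hub ≤ S.R a.hub := by
    have := List.pairwise_mergeSort (le := fun a b : Label V => decide (S.R b.hub ≤ S.R a.hub))
      (by simpa using fun a b c h1 h2 => le_trans h2 h1)
      (by simpa using fun a b => le_total _ _) (labelsAt L x).toList
    simpa [Setup.sortedLabels] using this
  have hnodup : (S.sortedLabels L x).Nodup :=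
    (List.mergeSort_perm _ _).nodup_iff.2 (Finset.nodup_toList _)
  refine (hsort.and hnodup).imp_of_mem fun {a b} ha hb h => lt_of_le_of_ne h.1 fun heq => h.2 ?_
  rw [Setup.mem_sortedLabels] at ha hb
  exact I.unique a ha.1 b hb.1 (ha.2.trans hb.2.symm) (S.R.injective heq).symm

/-- Queries are exact as soon as all canonical vertices of all trees were popped. -/
theorem TableInv.query_eq {L : Finset (Label V)} {g : V → History V} (I : TableInv S L g)
    (hpop : ∀ h x, S.Canon h x → x ∈ (g h).popped) (x y : V) :
    (S.query L x y).1 = S.dist x y := by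
  refine le_antisymm ?_ (Setup.le_mergeQuery _ _ fun a ha b hb hab => ?_)
  · by_cases hxy : S.dist x y = ⊤
    · rw [hxy]
      exact le_top
    · obtain ⟨h, hx, hy, hle⟩ := S.exists_canon_canon hxy
      refine (Setup.mergeQuery_le _ _ (I.pairwise_sortedLabels x) (I.pairwise_sortedLabels y)
        ⟨x, h, S.dist h x⟩ ?_ ⟨y, h, S.dist h y⟩ ?_ rfl).trans ?_
      · exact Setup.mem_sortedLabels.2 ⟨I.canon h x hx (hpop h x hx), rfl⟩
      · exact Setup.mem_sortedLabels.2 ⟨I.canon h y hy (hpop h y hy), rfl⟩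
      · rwa [Setup.dist, wdist_comm h x]
  · rw [Setup.mem_sortedLabels] at ha hb
    have ha' := I.dist_le a ha.1
    have hb' := I.dist_le b hb.1
    rw [ha.2] at ha'
    rw [hb.2, ← hab, Setup.dist, wdist_comm] at hb'
    exact (wdist_triangle x a.hub y).trans (add_le_add ha' hb')

theorem Setup.query_steps_le (L : Finset (Label V)) (x y : V) :
    (S.query L x y).2 ≤ (labelsAt L x).card + (labelsAt L y).card + 1 := by
  have := S.mergeQuery_steps_le (S.sortedLabels L x) (S.sortedLabels L y)
  rwa [Setup.length_sortedLabels, Setup.length_sortedLabels] at this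

end Query

/-! ### Termination -/

section Termination

theorem exists_isHead {V : Type u} {Q : Finset V} (hQ : Q.Nonempty) (δ : V → ℝ≥0∞) :
    ∃ x, IsHead Q δ x :=
  let ⟨x, hx, hmin⟩ := Finset.exists_min_image Q δ hQ
  ⟨x, hx, hmin⟩

variable {V : Type u} [Fintype V] {S : Setup V}

theorem Setup.Step.work_lt {C C' : Config V} (step : S.Step C C') : C.work < C'.work := by
  cases step <;> dsimp only [Setup.gllCost] <;> omega

/-- If no tree is running, the highest ranked waiting root of the current phase can be started. -/
theorem Setup.exists_canStart (hp : 1 ≤ S.p) {C : Config V}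
    (idle : ∀ h, C.status h = .waiting ∨ C.status h = .done)
    (hbatch : ∃ h, S.InBatch C.superstep h ∧ C.status h ≠ .done) : ∃ h, S.CanStart C h := by
  obtain ⟨h₁, hb₁, hd₁⟩ := hbatch
  have hw₁ := (idle h₁).resolve_right hd₁
  obtain ⟨h, hh, hmax⟩ := Finset.exists_max_image
    (Finset.univ.filter fun h => S.InBatch C.superstep h ∧ C.status h = .waiting) S.R
    ⟨h₁, by simp [hb₁, hw₁]⟩
  rw [Finset.mem_filter] at hh
  refine ⟨h, hh.2.1, hh.2.2, fun h' hb' _ hlt hw' => ?_, ?_⟩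
  · exact absurd (hmax h' (by simp [hb', hw'])) (not_le.2 hlt)
  · rw [Finset.card_eq_zero.2 (Finset.filter_eq_empty_iff.2 fun h' _ hh' => ?_)]
    · exact hp
    · exact (idle h').elim hh'.2.1 hh'.2.2

/-- The algorithm never gets stuck. -/
theorem Setup.exists_step (hp : 1 ≤ S.p) {C : Config V} (hfin : ¬ S.Finished C) :
    ∃ C', S.Step C C' := by
  by_cases idle : ∀ h, C.status h = .waiting ∨ C.status h = .done
  · by_cases complete : ∀ h, S.InBatch C.superstep h → C.status h = .done
    · by_cases phase : C.superstep = 0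
      · exact ⟨_, .switch C phase (phase ▸ complete)⟩
      · exact ⟨_, .sync C phase (not_le.1 hfin) complete⟩
    · push Not at complete
      obtain ⟨h, start⟩ := Setup.exists_canStart hp idle complete
      by_cases phase : C.superstep = 0
      · exact ⟨_, .startPlant C h phase start⟩
      · exact ⟨_, .startGll C h phase start⟩
  · push Not at idle
    obtain ⟨h, hw, hd⟩ := idle
    cases ht : C.status h with
    | waiting => exact absurd ht hw
    | done => exact absurd ht hd
    | plant t =>
      by_cases live : ∃ y ∈ t.queue, t.anc y = h
      · obtain ⟨y, hy, hyh⟩ := live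
        obtain ⟨x, hx⟩ := exists_isHead ⟨y, hy⟩ t.dist
        exact ⟨_, .iterPlant C h x t ht ⟨y, hy, hyh⟩ hx⟩
      · push Not at live
        exact ⟨_, .endPlant C h t ht live⟩
    | gll t =>
      rcases t.queue.eq_empty_or_nonempty with hQ | hQ
      · exact ⟨_, .endGll C h t ht hQ⟩
      · obtain ⟨x, hx⟩ := exists_isHead hQ t.dist
        exact ⟨_, .iterGll C h x t ht hx⟩

/-- Every step costs work, so a bound on the work bounds the number of steps. -/
theorem Setup.exists_finished (hp : 1 ≤ S.p) {W : ℕ}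
    (hW : ∀ C : Config V, S.Reaches Config.init C → C.work ≤ W) {C : Config V}
    (hC : S.Reaches Config.init C) : ∃ C', S.Reaches C C' ∧ S.Finished C' := by
  induction hn : W - C.work using Nat.strong_induction_on generalizing C with
  | _ n ih =>
  by_cases hfin : S.Finished C
  · exact ⟨C, .refl, hfin⟩
  · obtain ⟨C', step⟩ := Setup.exists_step hp hfin
    have hC' : S.Reaches Config.init C' := hC.tail step
    have hlt := step.work_lt
    have hle := hW C' hC'
    obtain ⟨C'', hreach, hfin''⟩ := ih (W - C'.work) (by omega) hC' rfl
    exact ⟨C'', .head step hreach, hfin''⟩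

end Termination

/-! ### Summation over all trees -/

section Counting

variable {V : Type u} [Fintype V] {S : Setup V}

/-- Double counting of the vertices reached by the pruned trees. -/
theorem Setup.HubBound.sum_le {B : ℕ} (hB : S.HubBound B) (f : V → ℕ) :
    ∑ h ∈ Finset.univ.filter (fun h => S.k ≤ S.treeId h),
      ∑ x ∈ Finset.univ.filter (S.LowReach h), f x ≤ B * ∑ x, f x := by
  rw [Finset.sum_comm' (t' := Finset.univ) (s' := fun x =>
    Finset.univ.filter fun h => S.k ≤ S.treeId h ∧ S.LowReach h x) (by simp), Finset.mul_sum]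
  refine Finset.sum_le_sum fun x _ => ?_
  rw [Finset.sum_const, smul_eq_mul]
  exact Nat.mul_le_mul_right _ (hB x)

theorem GlobalInv.sum_relaxed_le {B : ℕ} (hB : S.HubBound B) {C : Config V} {g : V → History V}
    (I : GlobalInv S B C g) :
    ∑ h ∈ Finset.univ.filter (fun h => S.k ≤ S.treeId h), (g h).relaxed.card ≤
      B * Fintype.card V := by
  calc _ ≤ ∑ h ∈ Finset.univ.filter (fun h => S.k ≤ S.treeId h),
        ∑ x ∈ Finset.univ.filter (S.LowReach h), 1 := by
        refine Finset.sum_le_sum fun h hh => ?_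
        rw [← Finset.card_eq_sum_ones]
        exact Finset.card_le_card fun x hx => Finset.mem_filter.2
          ⟨Finset.mem_univ x, I.low h x (Finset.mem_filter.1 hh).2 hx⟩
    _ ≤ B * ∑ x : V, 1 := hB.sum_le _
    _ = _ := by simp

theorem GlobalInv.broadcast_le_mul {B : ℕ} (hB : S.HubBound B) {C : Config V}
    {g : V → History V} (I : GlobalInv S B C g) : C.broadcast ≤ B * Fintype.card V := by
  by_cases h0 : C.superstep = 0
  · rw [I.broadcast_zero h0]
    exact Nat.zero_le _
  · exact (Nat.le_add_right _ _).trans ((I.broadcast_le h0).trans (I.sum_relaxed_le hB))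

theorem sum_split (k : ℕ) (f : V → ℕ) : ∑ h, f h =
    ∑ h ∈ Finset.univ.filter (fun h => S.treeId h < k), f h +
      ∑ h ∈ Finset.univ.filter (fun h => k ≤ S.treeId h), f h := by
  rw [← Finset.sum_filter_add_sum_filter_not Finset.univ fun h => S.treeId h < k]
  simp only [not_lt]

theorem GlobalInv.generated_le_mul {B : ℕ} (hB : S.HubBound B) {C : Config V}
    {g : V → History V} (I : GlobalInv S B C g) :
    C.generated ≤ (S.k + B) * Fintype.card V := by
  refine I.generated_le.trans ?_
  rw [sum_split (S := S) S.k, add_mul]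
  refine add_le_add ?_ (I.sum_relaxed_le hB)
  calc _ ≤ (Finset.univ.filter fun h => S.treeId h < S.k).card • Fintype.card V :=
        Finset.sum_le_card_nsmul _ _ _ fun h _ => Finset.card_le_univ _
    _ ≤ _ := Nat.mul_le_mul_right _ (Setup.card_treeId_lt_le _)

theorem Setup.sum_deg : ∑ x, S.deg x = 2 * S.G.edgeSet.ncard := by
  have := S.G.sum_degrees_eq_twice_card_edges
  rw [Set.ncard_eq_toFinset_card']
  convert this using 2 with x
  · rw [Setup.deg, Set.ncard_eq_toFinset_card', ← SimpleGraph.card_neighborFinset_eq_degree]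
    rfl
  · simp only [SimpleGraph.edgeFinset]

/-- At the end all labels are in the global tables and all trees are complete. -/
theorem GlobalInv.of_finished {B : ℕ} {C : Config V} {g : V → History V} (I : GlobalInv S B C g)
    (hfin : S.Finished C) :
    TableInv S C.glob g ∧ ∀ h x, S.Canon h x → x ∈ (g h).popped := by
  have hloc : C.loc = ∅ := Finset.eq_empty_of_forall_notMem fun l hl =>
    absurd (I.loc l hl) (not_le.2 ((Setup.treeId_lt l.hub).trans_le hfin))
  have htable := I.table
  rw [hloc, Finset.union_empty] at htable
  refine ⟨htable, fun h x hc => ?_⟩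
  have T := I.tree h
  rw [I.done h ((Setup.treeId_lt h).trans_le hfin)] at T
  exact DoneInv.canon T x hc

/-- Bound on the total work. -/
def Setup.workBudget (S : Setup V) (B : ℕ) : ℕ :=
  let n := Fintype.card V
  let m := S.G.edgeSet.ncard
  let H := Setup.heapCost (V := V)
  S.k * (2 + n + n * (2 + H) + 2 * m * (1 + H)) +
    (n * (4 + H + (S.k + B)) + B * (n * (S.k + B + 1) + 2 * m * (3 + 2 * H))) +
    (n * S.k * sortFactor V + (n + 1) + B * n * (sortFactor V + 1 + 2 * (S.k + B)))

theorem GlobalInv.work_le_budget {B : ℕ} (hB : S.HubBound B) {C : Config V}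
    {g : V → History V} (I : GlobalInv S B C g) : C.work ≤ S.workBudget B := by
  have hphase : S.phaseBudget B C.superstep C.broadcast ≤
      Fintype.card V * S.k * sortFactor V + (Fintype.card V + 1) +
        B * Fintype.card V * (sortFactor V + 1 + 2 * (S.k + B)) := by
    refine add_le_add (add_le_add ?_ I.superstep_le)
      (Nat.mul_le_mul_right _ (I.broadcast_le_mul hB))
    split_ifs
    · exact Nat.zero_le _
    · exact le_rfl
  have hcost : ∑ h, (g h).cost ≤
      ∑ h ∈ Finset.univ.filter (fun h => S.treeId h < S.k), S.plantBudget +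
        ∑ h ∈ Finset.univ.filter (fun h => S.k ≤ S.treeId h), S.gllBudget (S.k + B) h := by
    rw [sum_split (S := S) S.k]
    refine add_le_add (Finset.sum_le_sum fun h hh => ?_) (Finset.sum_le_sum fun h hh => ?_)
    · simpa [(Finset.mem_filter.1 hh).2] using (I.tree h).cost_le
    · simpa [not_lt.2 (Finset.mem_filter.1 hh).2] using (I.tree h).cost_le
  have hscan : ∀ x, S.scanCost x = S.deg x * (1 + Setup.heapCost (V := V)) := fun _ => rfl
  have hplant : ∑ h ∈ Finset.univ.filter (fun h => S.treeId h < S.k), S.plantBudget ≤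
      S.k * (2 + Fintype.card V + Fintype.card V * (2 + Setup.heapCost (V := V)) +
        2 * S.G.edgeSet.ncard * (1 + Setup.heapCost (V := V))) := by
    rw [Finset.sum_const, smul_eq_mul]
    refine Nat.mul_le_mul (Setup.card_treeId_lt_le _) (le_of_eq ?_)
    simp only [Setup.plantBudget, hscan, Finset.sum_add_distrib, Finset.sum_const,
      Finset.card_univ, smul_eq_mul, ← Finset.sum_mul, Setup.sum_deg]
    ring
  have hgll : ∑ h ∈ Finset.univ.filter (fun h => S.k ≤ S.treeId h), S.gllBudget (S.k + B) h ≤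
      Fintype.card V * (4 + Setup.heapCost (V := V) + (S.k + B)) +
        B * (Fintype.card V * (S.k + B + 1) +
          2 * S.G.edgeSet.ncard * (3 + 2 * Setup.heapCost (V := V))) := by
    simp only [Setup.gllBudget]
    rw [Finset.sum_add_distrib, Finset.sum_const, smul_eq_mul]
    refine add_le_add (Nat.mul_le_mul_right _ (Finset.card_le_univ _))
      ((hB.sum_le _).trans (Nat.mul_le_mul_left _ (le_of_eq ?_)))
    simp only [hscan, Finset.sum_add_distrib, Finset.sum_const,
      Finset.card_univ, smul_eq_mul, ← Finset.sum_mul, Setup.sum_deg]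
    ring
  have := I.work_le
  unfold Setup.workBudget
  dsimp only
  omega

end Counting

/-! ### Asymptotic bounds -/

section Asymptotics

/-- `Nat.log 2 n = O(log n)`, with an explicit constant. -/
theorem natLog_le_two_mul_log (n : ℕ) : (Nat.log 2 n : ℝ) ≤ 2 * Real.log n := by
  have h1 : (Nat.log 2 n : ℝ) ≤ Real.logb 2 n := by
    simpa using Real.natLog_le_logb n 2
  have h2 := Real.log_two_gt_d9
  rw [Real.logb, le_div_iff₀ (by linarith)] at h1
  have : (0 : ℝ) ≤ Nat.log 2 n := Nat.cast_nonneg _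
  nlinarith

theorem half_le_log {n : ℕ} (hn : 2 ≤ n) : 1 ≤ 2 * Real.log n := by
  have h1 : Real.log 2 ≤ Real.log n :=
    Real.log_le_log (by norm_num) (by exact_mod_cast hn)
  have h2 := Real.log_two_gt_d9
  linarith

/-- The budget is within the claimed bound if the heap cost `H` and the sorting factor `W` are
`O(ℓ)` and there are at most `B ≤ b c ℓ` hubs per vertex outside the root bag. -/
theorem budget_le {n m ℓ w c H W B b : ℝ} (hn : 2 ≤ n) (hm : 0 ≤ m) (hℓ : 1 ≤ 2 * ℓ)
    (hw : 0 ≤ w) (hc : 1 ≤ c) (hb : 1 ≤ b) (hH0 : 0 ≤ H) (hH : H ≤ 4 * ℓ)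
    (hW0 : 0 ≤ W) (hW : W ≤ 6 * ℓ) (hB0 : 0 ≤ B) (hB : B ≤ b * (c * ℓ)) :
    w * (2 + n + n * (2 + H) + 2 * m * (1 + H)) +
      (n * (4 + H + (w + B)) + B * (n * (w + B + 1) + 2 * m * (3 + 2 * H))) +
      (n * w * W + (n + 1) + B * n * (W + 1 + 2 * (w + B))) ≤
    (62 + 68 * b + 3 * b ^ 2) * (m * ℓ * (w + c * ℓ ^ 2) + n * c * ℓ * (w + c * ℓ)) := by
  have hℓ0 : 0 ≤ ℓ := by linarith
  obtain ⟨y, hy⟩ : ∃ y, y = c * ℓ := ⟨_, rfl⟩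
  have hℓy : ℓ ≤ y := by rw [hy]; nlinarith
  have hy0 : 0 ≤ y := hℓ0.trans hℓy
  have hy1 : 1 ≤ 2 * y := by linarith
  have hn0 : 0 ≤ n := by linarith
  have hb0 : 0 ≤ b := by linarith
  rw [← hy] at hB
  have hM : w + B ≤ b * (w + y) := by
    have := mul_le_mul_of_nonneg_right hb hw
    linarith
  have hT1 : m * ℓ * (w + c * ℓ ^ 2) = m * ℓ * w + m * y * ℓ ^ 2 := by rw [hy]; ring
  have hT2 : n * c * ℓ * (w + c * ℓ) = n * y * w + n * y * y := by rw [hy]; ring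
  rw [hT1, hT2]
  have e1 : w * (2 + n + n * (2 + H)) ≤ 12 * (n * y * w) := by
    have : 2 + n + n * (2 + H) ≤ n * (12 * y) := by
      have h1 := mul_le_mul_of_nonneg_left (by linarith : H ≤ 4 * y) hn0
      have h2 := mul_le_mul_of_nonneg_left hy1 hn0
      linarith
    calc w * (2 + n + n * (2 + H)) ≤ w * (n * (12 * y)) := mul_le_mul_of_nonneg_left this hw
      _ = _ := by ring
  have e2 : w * (2 * m * (1 + H)) ≤ 12 * (m * ℓ * w) := by
    calc w * (2 * m * (1 + H)) ≤ w * (2 * m * (6 * ℓ)) := by gcongr; linarith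
      _ = _ := by ring
  have e3 : n * (4 + H + (w + B)) ≤ (24 + 2 * b) * (n * y * w + n * y * y) := by
    have h1 : 12 * y ≤ 24 * (y * y) := by
      have := mul_le_mul_of_nonneg_right hy1 hy0
      linarith
    have h2 : b * (w + y) ≤ 2 * b * (y * (w + y)) := by
      have := mul_le_mul_of_nonneg_left
        (mul_le_mul_of_nonneg_right hy1 (add_nonneg hw hy0)) hb0
      linarith
    calc n * (4 + H + (w + B)) ≤ n * (24 * (y * y) + 2 * b * (y * (w + y))) :=
          mul_le_mul_of_nonneg_left (by linarith) hn0
      _ ≤ _ := by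
          have : 0 ≤ n * y * w := by positivity
          linarith
  have e4 : B * (n * (w + B + 1)) ≤ (b * (b + 2)) * (n * y * w + n * y * y) := by
    calc B * (n * (w + B + 1)) ≤ (b * y) * (n * ((b + 2) * (w + y))) := by
          gcongr
          linarith
      _ = _ := by ring
  have e5 : B * (2 * m * (3 + 2 * H)) ≤ 56 * b * (m * y * ℓ ^ 2) := by
    have h1 : 3 + 2 * H ≤ 28 * ℓ ^ 2 := by
      have := mul_le_mul_of_nonneg_right hℓ hℓ0
      linarith
    calc B * (2 * m * (3 + 2 * H)) ≤ (b * y) * (2 * m * (28 * ℓ ^ 2)) := by gcongr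
      _ = _ := by ring
  have e6 : n * w * W ≤ 6 * (n * y * w) := by
    calc n * w * W ≤ n * w * (6 * y) := by gcongr; linarith
      _ = _ := by ring
  have e7 : n + 1 ≤ 8 * (n * y * y) := by
    have h1 : 1 ≤ 4 * (y * y) := by
      have := mul_le_mul_of_nonneg_right hy1 hy0
      linarith
    have := mul_le_mul_of_nonneg_left h1 hn0
    linarith
  have e8 : B * n * (W + 1 + 2 * (w + B)) ≤ (b * (8 + 2 * b)) * (n * y * w + n * y * y) := by
    calc B * n * (W + 1 + 2 * (w + B)) ≤ (b * y) * n * ((8 + 2 * b) * (w + y)) := by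
          gcongr
          linarith
      _ = _ := by ring
  -- the excess of the right-hand side over the sum of the above estimates
  have rest : 0 ≤ (50 + 68 * b + 3 * b ^ 2) * (m * ℓ * w) +
      (62 + 12 * b + 3 * b ^ 2) * (m * y * ℓ ^ 2) + (20 + 56 * b) * (n * y * w) +
      (30 + 56 * b) * (n * y * y) := by positivity
  linarith

end Asymptotics

end

end HubLabeling

theorem mainTheorem4 (K : ℕ) :
    ∃ A : ℝ, 0 < A ∧
      ∀ (V : Type u) [Fintype V] (τ : Type v) [Fintype τ] (S : HubLabeling.Setup V) (w c : ℕ)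
        (D : HubLabeling.RelaxedTreeDecomposition S.G w c τ),
        2 ≤ Fintype.card V →
        1 ≤ c →
        Fintype.card τ ≤ Fintype.card V ^ K →
        (∀ e ∈ S.G.edgeSet, 0 < S.wt e) →
        D.Induces S.R →
        1 ≤ S.q → 1 ≤ S.p → (∀ i, 1 ≤ S.s i) →
        S.k = w →
        ∀ (n m ℓ : ℝ), n = Fintype.card V → m = S.G.edgeSet.ncard → ℓ = Real.log n →
        ∀ C : HubLabeling.Config V, S.Reaches HubLabeling.Config.init C →
          -- the execution can be continued until it is finished
          (∃ C', S.Reaches C C' ∧ S.Finished C') ∧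
          -- work, broadcast data and generated labels up to any point of the execution
          (C.work : ℝ) ≤ A * (m * ℓ * (w + c * ℓ ^ 2) + n * c * ℓ * (w + c * ℓ)) ∧
          (C.broadcast : ℝ) ≤ A * (c * n * ℓ) ∧
          (C.generated : ℝ) ≤ A * (n * (w + c * ℓ)) ∧
          -- size of the output and queries on the output
          (S.Finished C →
            (C.glob.card : ℝ) ≤ A * (n * (w + c * ℓ)) ∧
            ∀ x y : V,
              (S.query C.glob x y).1 = HubLabeling.wdist S.G S.wt x y ∧
              ((S.query C.glob x y).2 : ℝ) ≤ A * (w + c * ℓ)) := by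
  -- `b` is chosen such that `c (log₂ |τ| + 1) ≤ b c ℓ`, using `|τ| ≤ n ^ K`, `log₂ n ≤ 2 ℓ` and
  -- `1 ≤ 2 ℓ`
  obtain ⟨b, hb⟩ : ∃ b : ℝ, b = 2 * K + 2 := ⟨_, rfl⟩
  have hK : (0 : ℝ) ≤ K := Nat.cast_nonneg _
  have hb1 : 1 ≤ b := by linarith
  refine ⟨62 + 68 * b + 3 * b ^ 2, by positivity, ?_⟩
  intro V _ τ _ S w c D hn hc hτ hpos hD _ hp hs hk n m ℓ hn' hm' hℓ' C hC
  obtain ⟨B, hBdef⟩ : ∃ B : ℕ, B = c * (Nat.log 2 (Fintype.card τ) + 1) := ⟨_, rfl⟩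
  have hB : S.HubBound B := hBdef ▸ HubLabeling.Setup.hubBound_of_induces hD hk
  obtain ⟨g, I⟩ := HubLabeling.GlobalInv.of_reaches hpos hs hB hC
  have hn2 : 2 ≤ n := by rw [hn']; exact_mod_cast hn
  have hc1 : (1 : ℝ) ≤ c := by exact_mod_cast hc
  have hw0 : (0 : ℝ) ≤ w := Nat.cast_nonneg _
  have hℓ1 : 1 ≤ 2 * ℓ := by rw [hℓ', hn']; exact HubLabeling.half_le_log hn
  have hBℓ : (B : ℝ) ≤ b * (c * ℓ) := by
    have hlog : (Nat.log 2 (Fintype.card τ) : ℝ) ≤ 2 * K * ℓ := by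
      calc (Nat.log 2 (Fintype.card τ) : ℝ) ≤ Nat.log 2 (Fintype.card V ^ K) := by
            exact_mod_cast Nat.log_mono_right hτ
        _ ≤ 2 * Real.log ((Fintype.card V ^ K : ℕ) : ℝ) := HubLabeling.natLog_le_two_mul_log _
        _ = 2 * K * ℓ := by
            rw [Nat.cast_pow, Real.log_pow, hℓ', hn']
            ring
    have h1 : (Nat.log 2 (Fintype.card τ) : ℝ) + 1 ≤ b * ℓ := by rw [hb]; linarith
    have h2 := mul_le_mul_of_nonneg_left h1 (zero_le_one.trans hc1)
    rw [hBdef]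
    push_cast
    linarith
  have hbound : ∀ X : ℝ, 0 ≤ X → b * X ≤ (62 + 68 * b + 3 * b ^ 2) * X := fun X hX =>
    mul_le_mul_of_nonneg_right (by nlinarith) hX
  have hcℓ : 1 ≤ 2 * (c * ℓ) := by nlinarith
  have hM : (w : ℝ) + B ≤ b * (w + c * ℓ) := by
    have := mul_le_mul_of_nonneg_right hb1 hw0
    linarith
  have hwc : (0 : ℝ) ≤ w + c * ℓ := by linarith
  have hgen : (C.generated : ℝ) ≤ (62 + 68 * b + 3 * b ^ 2) * (n * (w + c * ℓ)) := by
    have h1 : (C.generated : ℝ) ≤ (w + B) * n := by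
      rw [hn', ← hk]
      exact_mod_cast I.generated_le_mul hB
    refine le_trans ?_ (hbound _ (mul_nonneg (by linarith) hwc))
    calc (C.generated : ℝ) ≤ (w + B) * n := h1
      _ ≤ b * (w + c * ℓ) * n := mul_le_mul_of_nonneg_right hM (by linarith)
      _ = _ := by ring
  refine ⟨HubLabeling.Setup.exists_finished hp (W := S.workBudget B) (fun C' hC' => ?_) hC, ?_,
    ?_, hgen, fun hfin => ?_⟩
  · obtain ⟨g', I'⟩ := HubLabeling.GlobalInv.of_reaches hpos hs hB hC'
    exact I'.work_le_budget hB
  · have hH : ((HubLabeling.Setup.heapCost (V := V) : ℕ) : ℝ) ≤ 4 * ℓ := by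
      have := HubLabeling.natLog_le_two_mul_log (Fintype.card V)
      rw [← hn', ← hℓ'] at this
      unfold HubLabeling.Setup.heapCost
      push_cast
      linarith
    have hW : ((HubLabeling.sortFactor V : ℕ) : ℝ) ≤ 6 * ℓ := by
      have := HubLabeling.natLog_le_two_mul_log (Fintype.card V * Fintype.card V)
      rw [Nat.cast_mul, ← hn', Real.log_mul (by linarith) (by linarith), ← hℓ'] at this
      unfold HubLabeling.sortFactor
      push_cast
      linarith
    refine le_trans ?_ (HubLabeling.budget_le hn2 (hm' ▸ Nat.cast_nonneg _) hℓ1 hw0 hc1 hb1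
      (Nat.cast_nonneg _) hH (Nat.cast_nonneg _) hW (Nat.cast_nonneg B) hBℓ)
    have hwork : (C.work : ℝ) ≤ (S.workBudget B : ℕ) := by exact_mod_cast I.work_le_budget hB
    refine hwork.trans (le_of_eq ?_)
    rw [HubLabeling.Setup.workBudget, hn', hm', ← hk]
    push_cast
    ring
  · have h1 : (C.broadcast : ℝ) ≤ B * n := by
      rw [hn']
      exact_mod_cast I.broadcast_le_mul hB
    refine le_trans ?_ (hbound _ (by nlinarith))
    calc (C.broadcast : ℝ) ≤ B * n := h1
      _ ≤ b * (c * ℓ) * n := mul_le_mul_of_nonneg_right hBℓ (by linarith)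
      _ = _ := by ring
  obtain ⟨htable, hpop⟩ := I.of_finished hfin
  refine ⟨?_, fun x y => ⟨?_, ?_⟩⟩
  · refine le_trans ?_ hgen
    exact_mod_cast (Nat.le_add_right _ _).trans I.glob_le
  · exact htable.query_eq hpop x y
  · have h1 := htable.card_labelsAt_le hB I.low x
    have h2 := htable.card_labelsAt_le hB I.low y
    have h3 := HubLabeling.Setup.query_steps_le (S := S) C.glob x y
    have h4 : ((S.query C.glob x y).2 : ℝ) ≤ 2 * (w + B) + 1 := by
      rw [← hk]
      exact_mod_cast (by omega : (S.query C.glob x y).2 ≤ 2 * (S.k + B) + 1)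
    calc ((S.query C.glob x y).2 : ℝ) ≤ (2 * b + 2) * (w + c * ℓ) := by linarith
      _ ≤ _ := mul_le_mul_of_nonneg_right (by nlinarith) hwc
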